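/- Let $T,\eta,p\in\mathbb R_{>0}$ (any $p\in(0,\infty)$) and $\Omega_T=(0,T)\times\mathbb R$. Let $q_0\in L^\infty(\mathbb R)$ have finite total variation and satisfy $q_0>q_{\min}$ almost everywhere for some constant $q_{\min}>0$, and let $V\in W^{2,\infty}_{\mathrm{loc}}(\mathbb R)$ (continuous representative) with $V'\le 0$ on $\mathbb R$. For $q\ge 0$ put $$W_{p,\eta}[q](t,x)=\Big(\tfrac p\eta\int_x^\infty\big(e^{(x-y)/\eta}q(t,y)\big)^p\,dy\Big)^{1/p}.$$ Let $q_\eta\in C([0,T];L^1_{\mathrm{loc}}(\mathbb R))\cap L^\infty((0,T);L^\infty(\mathbb R))$, $q_\eta\ge 0$, be a weak solution of $\partial_t q+\partial_x\big(V(W_{p,\eta}[q])\,q\big)=0$ on $\Omega_T$, $q(0,\cdot)=q_0$, i.e. for all $\phi\in C^1_c((-42,T)\times\mathbb R)$ $$\iint_{\Omega_T}\big(\partial_t\phi+V(W_{p,\eta}[q_\eta])\,\partial_x\phi\big)\,q_\eta\,dx\,dt+\int_{\mathbb R}q_0(x)\,\phi(0,x)\,dx=0 .$$ Write $W_\eta=W_{p,\eta}[q_\eta]$.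 Then $W_\eta$ is positive and Lipschitz continuous on $[0,T]\times\mathbb R$, and the following holds. 1. For every $t\in[0,T]$ and almost every $x\in\mathbb R$, $\partial_xW_\eta(t,x)$ exists and $$q_\eta^p(t,x)=W_\eta^p(t,x)-\eta\,W_\eta^{p-1}(t,x)\,\partial_xW_\eta(t,x).$$ 2. $W_\eta$ solves its own Cauchy problem: for almost every $(t,x)\in\Omega_T$ the partial derivatives $\partial_tW_\eta(t,x)$, $\partial_xW_\eta(t,x)$ exist, the integrals below converge absolutely, and $$\begin{aligned}\partial_tW_\eta(t,x)={}&-V(W_\eta(t,x))\,\partial_xW_\eta(t,x)\\&-W_\eta(t,x)^{1-p}\,\tfrac p\eta\int_x^\infty e^{(px-py)/\eta}\,V'(W_\eta(t,y))\,\partial_yW_\eta(t,y)\,W_\eta(t,y)^p\,dy\\&+W_\eta(t,x)^{1-p}\,(p-1)\int_x^\infty e^{(px-py)/\eta}\,V'(W_\eta(t,y))\,W_\eta(t,y)^{p-1}\,(\partial_yW_\eta(t,y))^2\,dy,\end{aligned}$$ and, for every $x\in\mathbb R$, $$W_\eta(0,x)=\Big(\tfrac p\eta\int_x^\infty\big(e^{(x-y)/\eta}q_0(y)\big)^p\,dy\Big)^{1/p}.$$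 3. If $q_\eta$ is moreover continuous on $\Omega_T$, then the identity in 1 and the equation in 2 hold at every $(t,x)\in\Omega_T$. -/

import Mathlib

open MeasureTheory Set Filter Topology

/-- `g` is the weak (distributional) derivative of `f` on the real line. -/
def IsWeakDerivOnLine (f g : ℝ → ℝ) : Prop :=
  LocallyIntegrable f volume ∧ LocallyIntegrable g volume ∧
    ∀ φ : ℝ → ℝ, ContDiff ℝ ((⊤ : ℕ∞) : WithTop ℕ∞) φ → HasCompactSupport φ →
      ∫ x, f x * deriv φ x = - ∫ x, g x * φ x

/-- `f` is essentially bounded on every bounded interval. -/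
def LocallyEssBounded (f : ℝ → ℝ) : Prop :=
  ∀ R : ℝ, ∃ C : ℝ, ∀ᵐ x : ℝ, |x| ≤ R → |f x| ≤ C

/-- `f` belongs to the local Sobolev space `W^{2,∞}_loc(ℝ)`. -/
def MemSobolevTwoInftyLoc (f : ℝ → ℝ) : Prop :=
  ∃ f₁ f₂ : ℝ → ℝ, IsWeakDerivOnLine f f₁ ∧ IsWeakDerivOnLine f₁ f₂ ∧
    LocallyEssBounded f ∧ LocallyEssBounded f₁ ∧ LocallyEssBounded f₂

/-- The (almost everywhere equivalence class of the) function `f` has finite total variation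
on the real line. -/
def HasFiniteTotalVariation (f : ℝ → ℝ) : Prop :=
  ∃ g : ℝ → ℝ, f =ᵐ[volume] g ∧ BoundedVariationOn g univ

/-- The assumption on the initial datum: essentially bounded, of finite total variation,
and bounded away from zero by `qmin > 0`. -/
structure InitialDatumAssumption (q₀ : ℝ → ℝ) (qmin : ℝ) : Prop where
  qmin_pos : 0 < qmin
  memLp : MemLp q₀ ⊤ volume
  gt_qmin : ∀ᵐ x : ℝ, qmin < q₀ x
  finite_tv : HasFiniteTotalVariation q₀

/-- The assumption on the velocity: (the continuous representative of) a `W^{2,∞}_loc` function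
which is nonincreasing. -/
structure VelocityAssumption (V : ℝ → ℝ) : Prop where
  continuous : Continuous V
  sobolev : MemSobolevTwoInftyLoc V
  deriv_nonpos : ∀ s : ℝ, deriv V s ≤ 0

/-- The nonlocal operator in the `p`-norm with the (normalized) exponential kernel. -/
noncomputable def expNonlocal (p η : ℝ) (q : ℝ → ℝ → ℝ) (t x : ℝ) : ℝ :=
  ((p / η) * ∫ y in Ioi x, (Real.exp ((x - y) / η) * q t y) ^ p) ^ (1 / p)

/-- The open space-time strip `(0,T) × ℝ`. -/
def spaceTime (T : ℝ) : Set (ℝ × ℝ) := Ioo 0 T ×ˢ (univ : Set ℝ)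

/-- `q ∈ C([0,T]; L¹_loc(ℝ))`. -/
def ContinuousIntoLocL1 (T : ℝ) (q : ℝ → ℝ → ℝ) : Prop :=
  (∀ t ∈ Icc 0 T, LocallyIntegrable (q t) volume) ∧
    ∀ s ∈ Icc 0 T, ∀ R : ℝ,
      Tendsto (fun t => ∫ x in Icc (-R) R, |q t x - q s x|) (𝓝[Icc 0 T] s) (𝓝 0)

/-- Nonnegative, essentially bounded weak solutions, in `C([0,T]; L¹_loc)`, of the nonlocal
conservation law `∂ₜ q + ∂ₓ (V(W[q]) q) = 0`, `q(0,·) = q₀`, with the exponential kernel.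
Because of the continuity in time, requiring the pointwise bounds for every `t` in `[0,T]` is the
same as requiring them almost everywhere in space-time. -/
structure IsNonlocalWeakSolution (T p η : ℝ) (V q₀ : ℝ → ℝ) (q : ℝ → ℝ → ℝ) : Prop where
  continuous_locL1 : ContinuousIntoLocL1 T q
  aestronglyMeasurable :
    AEStronglyMeasurable (fun z : ℝ × ℝ => q z.1 z.2) (volume.restrict (spaceTime T))
  nonneg : ∀ t ∈ Icc 0 T, ∀ᵐ x : ℝ, 0 ≤ q t x
  bounded : ∃ C : ℝ, ∀ t ∈ Icc 0 T, ∀ᵐ x : ℝ, q t x ≤ C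
  weak_form : ∀ φ : ℝ × ℝ → ℝ, ContDiff ℝ 1 φ → HasCompactSupport φ →
    tsupport φ ⊆ Ioo (-42) T ×ˢ (univ : Set ℝ) →
      (∫ z in spaceTime T,
          (deriv (fun s => φ (s, z.2)) z.1
            + V (expNonlocal p η q z.1 z.2) * deriv (fun y => φ (z.1, y)) z.2) * q z.1 z.2)
        + ∫ x, q₀ x * φ (0, x) = 0

/-- `W(t,·)` is differentiable at `x` and `q^p = W^p - η W^{p-1} ∂ₓW` holds at `(t,x)`. -/
def NonlocalIdentityAt (p η : ℝ) (q W : ℝ → ℝ → ℝ) (t x : ℝ) : Prop :=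
  DifferentiableAt ℝ (W t) x ∧
    q t x ^ p = W t x ^ p - η * W t x ^ (p - 1) * deriv (W t) x

/-- At `(t,x)` both partial derivatives of `W` exist, both integrals converge, and the closed
nonlocal transport equation for `W` holds. -/
def NonlocalTransportAt (p η : ℝ) (V : ℝ → ℝ) (W : ℝ → ℝ → ℝ) (t x : ℝ) : Prop :=
  DifferentiableAt ℝ (fun s => W s x) t ∧ DifferentiableAt ℝ (W t) x ∧
  IntegrableOn (fun y => Real.exp ((p * x - p * y) / η) * deriv V (W t y) * deriv (W t) y
    * W t y ^ p) (Ioi x) ∧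
  IntegrableOn (fun y => Real.exp ((p * x - p * y) / η) * deriv V (W t y) * W t y ^ (p - 1)
    * deriv (W t) y ^ 2) (Ioi x) ∧
  deriv (fun s => W s x) t =
    - V (W t x) * deriv (W t) x
    - W t x ^ (1 - p) * (p / η) *
        (∫ y in Ioi x, Real.exp ((p * x - p * y) / η) * deriv V (W t y) * deriv (W t) y
          * W t y ^ p)
    + W t x ^ (1 - p) * (p - 1) *
        (∫ y in Ioi x, Real.exp ((p * x - p * y) / η) * deriv V (W t y) * W t y ^ (p - 1)
          * deriv (W t) y ^ 2)

/-! Put k = p/η, U = W^p and u = ∂ₓU. Since U(t,x) = k ∫_x^∞ e^{k(x-y)} q(t,y)^p dy, differentiating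
in x gives u = k (U - q^p) at Lebesgue points of q^p. This is the identity of part 1, and it says
that q^p can be recovered from U as U - u/k.

For the time derivative one needs the equation satisfied by q^p, although q is only a bounded weak
solution. The velocity b = V(W) is bounded and Lipschitz in x, so the equation can be renormalized:
∂ₜβ(q) + ∂ₓ(b β(q)) = (β(q) - β'(q) q) ∂ₓb. The density is averaged over short intervals [x, x+h].
The x-derivative of such an average is exactly the difference quotient of q, so the averaged
equation is a transport equation with an explicit remainder, and no commutator estimate is needed
(`ContinuityEquation.expTail_boxAvg_sub`). Tested with the exponential kernel, it passes to the
limit h → 0 (`ContinuityEquation.ae_expTail_comp_sub`). As s^p need not be C¹ at 0, the power is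
reached through (s+δ)^p (`ContinuityEquation.ae_expTail_rpow_sub`). Substituting q^p = U - u/k and
integrating by parts once removes q altogether (`NonlocalDensity.mul_renormalizedFlux`); the chain
rule for s^{1/p} then gives the equation for W.

That chain rule, and the Lipschitz bound on b, require U to stay away from 0. Mass can leave an
interval only through its two endpoints at bounded speed, so on a long enough interval some of the
initial mass, at least qmin per unit length, is still present at time T
(`exists_lower_bound_expTail_rpow`). This uses only boundedness of the flux, so the argument is not
circular.

The integrated identities first hold for almost every x, with a null set independent of t.
Continuity extends the resulting time-Lipschitz bound, and for continuous q also the identity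
itself, to every x. -/

/-! ### Calculus for Lipschitz functions -/

/-- The fundamental theorem of calculus for a function that is Lipschitz on an interval. -/
theorem LipschitzOnWith.integral_eq_sub_of_ae_hasDerivAt {f f' : ℝ → ℝ} {a b : ℝ} {K : NNReal}
    (hf : LipschitzOnWith K f (uIcc a b)) (hd : ∀ᵐ x, x ∈ uIcc a b → HasDerivAt f (f' x) x) :
    ∫ x in a..b, f' x = f b - f a := by
  rw [← hf.absolutelyContinuousOnInterval.integral_deriv_eq_sub]
  apply intervalIntegral.integral_congr_ae
  filter_upwards [hd] with x hx hxab
  exact (hx (uIoc_subset_uIcc hxab)).deriv.symm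

theorem abs_intervalIntegral_le_of_bound {g : ℝ → ℝ} {C : ℝ} (hb : ∀ x, |g x| ≤ C) (a b : ℝ) :
    |∫ x in a..b, g x| ≤ C * |b - a| := by
  simpa using! intervalIntegral.norm_integral_le_of_norm_le_const (f := g) (C := C) (a := a) (b := b)
    (fun x _ => hb x)

theorem intervalIntegrable_of_bound {g : ℝ → ℝ} {C : ℝ} (hm : Measurable g)
    (hb : ∀ x, |g x| ≤ C) (a b : ℝ) : IntervalIntegrable g volume a b := by
  rw [intervalIntegrable_iff]
  exact Measure.integrableOn_of_bounded (M := C) (by simp) hm.aestronglyMeasurable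
    (Eventually.of_forall hb)

theorem locallyIntegrable_of_bound {g : ℝ → ℝ} {C : ℝ} (hm : Measurable g)
    (hb : ∀ x, |g x| ≤ C) : LocallyIntegrable g volume := by
  refine (locallyIntegrable_const C).mono hm.aestronglyMeasurable (Eventually.of_forall fun x => ?_)
  exact (hb x).trans (le_abs_self C)

theorem lipschitzWith_intervalIntegral_of_bound {g : ℝ → ℝ} {C : ℝ} (hm : Measurable g)
    (hb : ∀ x, |g x| ≤ C) (a : ℝ) :
    LipschitzWith C.toNNReal (fun t => ∫ s in a..t, g s) := by
  have hC : 0 ≤ C := (abs_nonneg _).trans (hb 0)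
  refine LipschitzWith.of_dist_le_mul fun x y => ?_
  rw [Real.dist_eq, Real.dist_eq, intervalIntegral.integral_interval_sub_left
    (intervalIntegrable_of_bound hm hb _ _) (intervalIntegrable_of_bound hm hb _ _),
    Real.coe_toNNReal _ hC]
  exact abs_intervalIntegral_le_of_bound hb _ _

/-- Chain rule along an indefinite integral. -/
theorem comp_indefinite_integral_sub {g β β' : ℝ → ℝ} {C M f₀ a b T : ℝ} (hm : Measurable g)
    (hb : ∀ x, |g x| ≤ C) (hβ : ∀ r ∈ Icc a b, HasDerivAt β (β' r) r)
    (hβ' : ∀ r ∈ Icc a b, |β' r| ≤ M)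
    (hf : ∀ t ∈ Icc 0 T, f₀ + ∫ s in 0..t, g s ∈ Icc a b) {t : ℝ} (ht : t ∈ Icc 0 T) :
    β (f₀ + ∫ s in 0..t, g s) - β f₀ =
      ∫ τ in 0..t, β' (f₀ + ∫ s in 0..τ, g s) * g τ := by
  have hL : LipschitzWith C.toNNReal (fun t => f₀ + ∫ s in 0..t, g s) := by
    have := lipschitzWith_intervalIntegral_of_bound hm hb 0
    refine LipschitzWith.of_dist_le_mul fun x y => ?_
    simpa using this.dist_le_mul x y
  have hLβ : LipschitzOnWith M.toNNReal β (Icc a b) := by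
    refine (convex_Icc a b).lipschitzOnWith_of_nnnorm_hasDerivWithin_le (f' := β')
      (fun r hr => (hβ r hr).hasDerivWithinAt) fun r hr => ?_
    rw [← NNReal.coe_le_coe, coe_nnnorm]
    exact (hβ' r hr).trans (Real.le_coe_toNNReal M)
  have hsub : uIcc 0 t ⊆ Icc 0 T := by
    rw [uIcc_of_le ht.1]; exact Icc_subset_Icc_right ht.2
  have hcomp := hLβ.comp (hL.lipschitzOnWith (s := uIcc 0 t)) fun s hs => hf s (hsub hs)
  have := hcomp.integral_eq_sub_of_ae_hasDerivAt
    (f' := fun τ => β' (f₀ + ∫ s in 0..τ, g s) * g τ) (by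
      filter_upwards [LocallyIntegrable.ae_hasDerivAt_integral (locallyIntegrable_of_bound hm hb)] with τ hτ hτt
      exact (hβ _ (hf τ (hsub hτt))).comp τ ((hτ 0).const_add f₀))
  simpa using this.symm

/-! ### Exponentially weighted tails -/

/-- The one-sided exponential average `∫_x^∞ e^{k(x-y)} g(y) dy`. -/
noncomputable def expTail (k : ℝ) (g : ℝ → ℝ) (x : ℝ) : ℝ :=
  ∫ y in Ioi x, Real.exp (k * (x - y)) * g y

section expTail

variable {k C : ℝ} {g : ℝ → ℝ}

theorem integrableOn_exp_mul_sub (hk : 0 < k) (x a : ℝ) :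
    IntegrableOn (fun y => Real.exp (k * (x - y))) (Ioi a) := by
  have h := (integrableOn_exp_mul_Ioi (a := -k) (by linarith) a).const_mul (Real.exp (k * x))
  refine h.congr (Eventually.of_forall fun y => ?_)
  simp only [← Real.exp_add]; congr 1; ring

theorem integral_exp_mul_sub (hk : 0 < k) (x a : ℝ) :
    ∫ y in Ioi a, Real.exp (k * (x - y)) = Real.exp (k * (x - a)) / k := by
  have : (fun y => Real.exp (k * (x - y))) = fun y => Real.exp (k * x) * Real.exp (-k * y) := by
    ext y; rw [← Real.exp_add]; congr 1; ring
  rw [this, integral_const_mul, integral_exp_mul_Ioi (by linarith) a,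
    show k * (x - a) = k * x + -k * a by ring, Real.exp_add]
  field_simp

theorem integrableOn_exp_mul (hk : 0 < k) (hm : Measurable g) (hb : ∀ y, |g y| ≤ C) (x a : ℝ) :
    IntegrableOn (fun y => Real.exp (k * (x - y)) * g y) (Ioi a) := by
  refine ((integrableOn_exp_mul_sub hk x a).mul_const C).mono (by fun_prop)
    (Eventually.of_forall fun y => ?_)
  simp only [norm_mul, Real.norm_eq_abs]
  exact mul_le_mul_of_nonneg_left ((hb y).trans (le_abs_self C)) (abs_nonneg _)

theorem expTail_congr_ae {g₁ g₂ : ℝ → ℝ} (h : g₁ =ᵐ[volume] g₂) (x : ℝ) :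
    expTail k g₁ x = expTail k g₂ x := by
  refine integral_congr_ae ?_
  filter_upwards [ae_restrict_of_ae h] with y hy
  rw [hy]

theorem abs_expTail_le (hk : 0 < k) (hb : ∀ y, |g y| ≤ C) (x : ℝ) :
    |expTail k g x| ≤ C / k := by
  have h := norm_integral_le_of_norm_le ((integrableOn_exp_mul_sub hk x x).mul_const C)
    (f := fun y => Real.exp (k * (x - y)) * g y) (Eventually.of_forall fun y => by
      simp only [norm_mul, Real.norm_eq_abs, abs_of_pos (Real.exp_pos _)]
      gcongr
      exact hb y)
  rw [integral_mul_const, integral_exp_mul_sub hk] at h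
  simpa [expTail, div_eq_inv_mul] using h

theorem expTail_add {g₁ g₂ : ℝ → ℝ} {C₁ C₂ : ℝ} (hk : 0 < k) (h1 : Measurable g₁)
    (h2 : Measurable g₂) (hb1 : ∀ y, |g₁ y| ≤ C₁) (hb2 : ∀ y, |g₂ y| ≤ C₂) (x : ℝ) :
    expTail k (fun y => g₁ y + g₂ y) x = expTail k g₁ x + expTail k g₂ x := by
  simp only [expTail, mul_add]
  exact integral_add (integrableOn_exp_mul hk h1 hb1 x x) (integrableOn_exp_mul hk h2 hb2 x x)

theorem expTail_const_mul (c : ℝ) (x : ℝ) :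
    expTail k (fun y => c * g y) x = c * expTail k g x := by
  simp only [expTail, ← integral_const_mul]
  congr 1; ext y; ring

theorem expTail_sub {g₁ g₂ : ℝ → ℝ} {C₁ C₂ : ℝ} (hk : 0 < k) (h1 : Measurable g₁)
    (h2 : Measurable g₂) (hb1 : ∀ y, |g₁ y| ≤ C₁) (hb2 : ∀ y, |g₂ y| ≤ C₂) (x : ℝ) :
    expTail k (fun y => g₁ y - g₂ y) x = expTail k g₁ x - expTail k g₂ x := by
  rw [expTail, expTail, expTail, ← integral_sub (integrableOn_exp_mul hk h1 hb1 x x) (integrableOn_exp_mul hk h2 hb2 x x)]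
  simp only [mul_sub]

theorem expTail_comp_add_right (h x : ℝ) :
    expTail k (fun y => g (y + h)) x = expTail k g (x + h) := by
  have := integral_add_right_eq_self (μ := volume)
    (fun z => (Ioi (x + h)).indicator (fun z => Real.exp (k * (x + h - z)) * g z) z) h
  simp only [expTail]
  rw [← integral_indicator measurableSet_Ioi, ← integral_indicator measurableSet_Ioi, ← this]
  congr 1; ext y
  simp only [indicator, mem_Ioi, add_lt_add_iff_right]
  congr 3; ring

/-- Factoring out e^{kx} leaves x only in the limit of an ordinary integral, so differentiability of
the tail reduces to that of a primitive. -/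
theorem expTail_eq_integral (hk : 0 < k) (hm : Measurable g) (hb : ∀ y, |g y| ≤ C) (x : ℝ) :
    expTail k g x = Real.exp (k * x) *
      (expTail k g 0 - ∫ y in 0..x, Real.exp (-(k * y)) * g y) := by
  have hi : ∀ a, IntegrableOn (fun y => Real.exp (-(k * y)) * g y) (Ioi a) := fun a => by
    simpa using integrableOn_exp_mul hk hm hb 0 a
  have h1 := intervalIntegral.integral_Ioi_sub_Ioi' (hi 0) (hi x)
  have h2 : ∀ a x, ∫ y in Ioi a, Real.exp (k * (x - y)) * g y =
      Real.exp (k * x) * ∫ y in Ioi a, Real.exp (-(k * y)) * g y := fun a x => by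
    rw [← integral_const_mul]; congr 1; ext y
    rw [← mul_assoc, ← Real.exp_add]; congr 2; ring
  rw [expTail, expTail, h2, h2, ← h1]
  simp

theorem hasDerivAt_expTail (hk : 0 < k) (hm : Measurable g) (hb : ∀ y, |g y| ≤ C) {x : ℝ}
    (h : HasDerivAt (fun x => ∫ y in 0..x, Real.exp (-(k * y)) * g y)
      (Real.exp (-(k * x)) * g x) x) :
    HasDerivAt (expTail k g) (k * expTail k g x - g x) x := by
  have he : HasDerivAt (fun x => Real.exp (k * x)) (Real.exp (k * x) * k) x := by
    simpa using ((hasDerivAt_id x).const_mul k).exp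
  have := he.mul (h.const_sub (expTail k g 0))
  rw [show expTail k g = fun x => Real.exp (k * x) *
      (expTail k g 0 - ∫ y in 0..x, Real.exp (-(k * y)) * g y) from
    funext (expTail_eq_integral hk hm hb)]
  refine this.congr_deriv ?_
  have e : Real.exp (k * x) * Real.exp (-(k * x)) = 1 := by rw [← Real.exp_add]; simp
  linear_combination (-g x) * e

theorem ae_hasDerivAt_expTail (hk : 0 < k) (hm : Measurable g) (hb : ∀ y, |g y| ≤ C) :
    ∀ᵐ x, HasDerivAt (expTail k g) (k * expTail k g x - g x) x := by
  have : LocallyIntegrable (fun y => Real.exp (-(k * y)) * g y) volume := by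
    have hc : Continuous fun y => Real.exp (-(k * y)) * C := by fun_prop
    refine hc.locallyIntegrable.mono (by fun_prop) (Eventually.of_forall fun y => ?_)
    simp only [norm_mul, Real.norm_eq_abs]
    exact mul_le_mul_of_nonneg_left ((hb y).trans (le_abs_self C)) (abs_nonneg _)
  filter_upwards [LocallyIntegrable.ae_hasDerivAt_integral this] with x hx
  exact hasDerivAt_expTail hk hm hb (hx 0)

theorem hasDerivAt_expTail_of_continuous (hk : 0 < k) (hc : Continuous g) (hb : ∀ y, |g y| ≤ C)
    (x : ℝ) : HasDerivAt (expTail k g) (k * expTail k g x - g x) x :=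
  hasDerivAt_expTail hk hc.measurable hb
    (Continuous.integral_hasStrictDerivAt (by fun_prop) 0 x).hasDerivAt

theorem expTail_eq_add (hk : 0 < k) (hm : Measurable g) (hb : ∀ y, |g y| ≤ C) (x y : ℝ) :
    expTail k g x = (∫ z in x..y, Real.exp (k * (x - z)) * g z) +
      Real.exp (k * (x - y)) * expTail k g y := by
  have h1 := intervalIntegral.integral_Ioi_sub_Ioi' (integrableOn_exp_mul hk hm hb x x)
    (integrableOn_exp_mul hk hm hb x y)
  rw [expTail, expTail, ← h1, ← integral_const_mul]
  have : ∀ z, Real.exp (k * (x - y)) * (Real.exp (k * (y - z)) * g z) =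
      Real.exp (k * (x - z)) * g z := fun z => by
    rw [← mul_assoc, ← Real.exp_add]; congr 2; ring
  simp only [this]; ring

/-- The constant does not depend on k. One C comes from the piece of the integral between the two
points; the other from the change of weight, where 1 - e^{-k(y-x)} ≤ k(y-x) meets the bound C/k on
the tail. -/
theorem lipschitzWith_expTail (hk : 0 < k) (hm : Measurable g) (hb : ∀ y, |g y| ≤ C) :
    LipschitzWith (2 * C).toNNReal (expTail k g) := by
  have hC : 0 ≤ C := (abs_nonneg _).trans (hb 0)
  refine LipschitzWith.of_le_add_mul _ ?_
  have key : ∀ x y, x ≤ y → |expTail k g x - expTail k g y| ≤ 2 * C * (y - x) := by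
    intro x y hxy
    rw [expTail_eq_add hk hm hb x y]
    have h1 : |∫ z in x..y, Real.exp (k * (x - z)) * g z| ≤ C * (y - x) := by
      have := intervalIntegral.norm_integral_le_of_norm_le_const (a := x) (b := y)
        (f := fun z => Real.exp (k * (x - z)) * g z) (C := C) (fun z hz => by
          rw [uIoc_of_le hxy] at hz
          rw [norm_mul, Real.norm_eq_abs, abs_of_pos (Real.exp_pos _)]
          have : Real.exp (k * (x - z)) ≤ 1 := Real.exp_le_one_iff.2 (by nlinarith [hz.1])
          exact (mul_le_mul this (hb z) (abs_nonneg _) zero_le_one).trans (by simp))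
      rwa [abs_of_nonneg (sub_nonneg.2 hxy)] at this
    have h2 : |(1 - Real.exp (k * (x - y))) * expTail k g y| ≤ C * (y - x) := by
      rw [abs_mul]
      have e1 : |1 - Real.exp (k * (x - y))| ≤ k * (y - x) := by
        rw [abs_of_nonneg]
        · linarith [Real.add_one_le_exp (k * (x - y))]
        · linarith [Real.exp_le_one_iff.2 (show k * (x - y) ≤ 0 by nlinarith)]
      refine (mul_le_mul e1 (abs_expTail_le hk hb y) (abs_nonneg _) (by nlinarith)).trans ?_
      exact le_of_eq (by field_simp)
    have : (∫ z in x..y, Real.exp (k * (x - z)) * g z) + Real.exp (k * (x - y)) * expTail k g y -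
        expTail k g y = (∫ z in x..y, Real.exp (k * (x - z)) * g z) -
          (1 - Real.exp (k * (x - y))) * expTail k g y := by ring
    rw [this]
    exact (abs_sub _ _).trans (by linarith)
  intro x y
  rw [Real.coe_toNNReal _ (by positivity), Real.dist_eq]
  rcases le_total x y with h | h
  · have := key x y h
    rw [abs_of_nonpos (by linarith : x - y ≤ 0)]
    linarith [le_abs_self (expTail k g x - expTail k g y)]
  · have := key y x h
    rw [abs_of_nonneg (by linarith : 0 ≤ x - y)]
    linarith [neg_abs_le (expTail k g y - expTail k g x)]

/-- Integration by parts for exponentially weighted tails. -/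
theorem expTail_of_ae_hasDerivAt {F f : ℝ → ℝ} {M : ℝ} {K : NNReal} (hk : 0 < k)
    (hF : LipschitzWith K F) (hFb : ∀ y, |F y| ≤ M) (hm : Measurable f) (hb : ∀ y, |f y| ≤ C)
    (hd : ∀ᵐ y, HasDerivAt F (f y) y) (x : ℝ) :
    expTail k f x = k * expTail k F x - F x := by
  have hFm := hF.continuous.measurable
  -- The defect D satisfies D' = kD almost everywhere, so e^{-ky} D(y) is constant; since D is
  -- bounded, letting y → ∞ shows that the constant is 0.
  set D : ℝ → ℝ := fun x => expTail k f x - k * expTail k F x + F x with hD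
  have hDb : ∀ y, |D y| ≤ C / k + k * (M / k) + M := fun y => by
    refine (abs_add_le _ _).trans (add_le_add ((abs_sub _ _).trans (add_le_add
      (abs_expTail_le hk hb y) ?_)) (hFb y))
    rw [abs_mul, abs_of_pos hk]
    gcongr
    exact abs_expTail_le hk hFb y
  have hconst : ∀ y, Real.exp (-(k * y)) * D y = Real.exp (-(k * x)) * D x := by
    intro y
    have hDac : AbsolutelyContinuousOnInterval D x y :=
      (((lipschitzWith_expTail hk hm hb).lipschitzOnWith.absolutelyContinuousOnInterval).fun_sub
        ((lipschitzWith_expTail hk hFm hFb).lipschitzOnWith.absolutelyContinuousOnInterval.const_mul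
          k)).fun_add hF.lipschitzOnWith.absolutelyContinuousOnInterval
    have hac : AbsolutelyContinuousOnInterval (fun y => Real.exp (-(k * y)) * D y) x y := by
      refine AbsolutelyContinuousOnInterval.fun_mul ?_ hDac
      exact ContDiffOn.absolutelyContinuousOnInterval (by fun_prop)
    obtain ⟨c, hc⟩ := hac.const_of_ae_hasDerivAt_zero (by
      filter_upwards [ae_hasDerivAt_expTail hk hm hb, ae_hasDerivAt_expTail hk hFm hFb, hd]
        with z h1 h2 h3 _
      have he : HasDerivAt (fun x => Real.exp (-(k * x))) (Real.exp (-(k * z)) * (-k)) z := by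
        simpa using ((hasDerivAt_id z).const_mul k).neg.exp
      refine (he.mul ((h1.sub (h2.const_mul k)).add h3)).congr_deriv ?_
      simp only [Pi.add_apply, Pi.sub_apply]
      ring)
    rw [hc y right_mem_uIcc, hc x left_mem_uIcc]
  have hlim : Tendsto (fun y => Real.exp (-(k * y)) * D y) atTop (𝓝 0) := by
    refine squeeze_zero_norm (a := fun y => Real.exp (-(k * y)) * (C / k + k * (M / k) + M))
      (fun y => ?_) ?_
    · rw [norm_mul, Real.norm_eq_abs, abs_of_pos (Real.exp_pos _)]
      exact mul_le_mul_of_nonneg_left (hDb y) (Real.exp_pos _).le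
    · simpa using (Real.tendsto_exp_neg_atTop_nhds_zero.comp
        (tendsto_id.const_mul_atTop hk)).mul_const (C / k + k * (M / k) + M)
  have h0 := tendsto_nhds_unique (hlim.congr hconst) tendsto_const_nhds
  have : D x = 0 := by
    rcases mul_eq_zero.1 h0.symm with h | h
    · exact absurd h (Real.exp_pos _).ne'
    · exact h
  simp only [hD] at this
  linarith

end expTail

/-! ### Bounded fields that are continuous in time, locally in measure -/

/-- A bounded Borel function `f t x` such that `t ↦ f t` is continuous for local convergence in
measure (expressed through almost everywhere convergent subsequences). -/
structure RegularField (f : ℝ → ℝ → ℝ) : Prop where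
  measurable : Measurable (Function.uncurry f)
  bounded : ∃ C, ∀ t x, |f t x| ≤ C
  subseq : ∀ (s : ℝ) (u : ℕ → ℝ), Tendsto u atTop (𝓝 s) → ∃ φ : ℕ → ℕ, StrictMono φ ∧
    ∀ᵐ x, Tendsto (fun n => f (u (φ n)) x) atTop (𝓝 (f s x))

namespace RegularField

variable {f g : ℝ → ℝ → ℝ} {k : ℝ}

theorem measurable_section (hf : RegularField f) (t : ℝ) : Measurable (f t) :=
  hf.measurable.comp measurable_prodMk_left

theorem measurable_time (hf : RegularField f) (x : ℝ) : Measurable (fun t => f t x) :=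
  hf.measurable.comp measurable_prodMk_right

theorem of_continuous (hf : Continuous (Function.uncurry f)) (hb : ∃ C, ∀ t x, |f t x| ≤ C) :
    RegularField f where
  measurable := hf.measurable
  bounded := hb
  subseq s _ hu := ⟨id, strictMono_id, Eventually.of_forall fun _ =>
    ((hf.comp (continuous_id.prodMk continuous_const)).tendsto s).comp hu⟩

theorem const (c : ℝ) : RegularField fun _ _ => c :=
  of_continuous continuous_const ⟨|c|, fun _ _ => le_rfl⟩

theorem add (hf : RegularField f) (hg : RegularField g) :
    RegularField fun t x => f t x + g t x where
  measurable := hf.measurable.add hg.measurable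
  bounded := by
    obtain ⟨C, hC⟩ := hf.bounded
    obtain ⟨D, hD⟩ := hg.bounded
    exact ⟨C + D, fun t x => (abs_add_le _ _).trans (add_le_add (hC t x) (hD t x))⟩
  subseq s u hu := by
    obtain ⟨φ, hφ, h1⟩ := hf.subseq s u hu
    obtain ⟨ψ, hψ, h2⟩ := hg.subseq s _ (hu.comp hφ.tendsto_atTop)
    refine ⟨φ ∘ ψ, hφ.comp hψ, ?_⟩
    filter_upwards [h1, h2] with x h1 h2
    exact (h1.comp hψ.tendsto_atTop).add h2

theorem mul (hf : RegularField f) (hg : RegularField g) :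
    RegularField fun t x => f t x * g t x where
  measurable := hf.measurable.mul hg.measurable
  bounded := by
    obtain ⟨C, hC⟩ := hf.bounded
    obtain ⟨D, hD⟩ := hg.bounded
    exact ⟨C * D, fun t x => by
      rw [abs_mul]
      exact mul_le_mul (hC t x) (hD t x) (abs_nonneg _) ((abs_nonneg _).trans (hC t x))⟩
  subseq s u hu := by
    obtain ⟨φ, hφ, h1⟩ := hf.subseq s u hu
    obtain ⟨ψ, hψ, h2⟩ := hg.subseq s _ (hu.comp hφ.tendsto_atTop)
    refine ⟨φ ∘ ψ, hφ.comp hψ, ?_⟩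
    filter_upwards [h1, h2] with x h1 h2
    exact (h1.comp hψ.tendsto_atTop).mul h2

theorem const_mul (hf : RegularField f) (c : ℝ) : RegularField fun t x => c * f t x :=
  (const c).mul hf

theorem sub (hf : RegularField f) (hg : RegularField g) :
    RegularField fun t x => f t x - g t x := by
  simpa [sub_eq_add_neg] using hf.add (hg.const_mul (-1))

theorem comp {h : ℝ → ℝ} {a b : ℝ} (hf : RegularField f) (hm : Measurable h)
    (hc : ContinuousOn h (Icc a b)) (hfab : ∀ t x, f t x ∈ Icc a b) :
    RegularField fun t x => h (f t x) where
  measurable := hm.comp hf.measurable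
  bounded := by
    obtain ⟨C, hC⟩ := isCompact_Icc.exists_bound_of_continuousOn hc
    exact ⟨C, fun t x => hC _ (hfab t x)⟩
  subseq s u hu := by
    obtain ⟨φ, hφ, h1⟩ := hf.subseq s u hu
    refine ⟨φ, hφ, ?_⟩
    filter_upwards [h1] with x h1
    exact (hc _ (hfab s x)).tendsto.comp
      (tendsto_nhdsWithin_iff.2 ⟨h1, Eventually.of_forall fun n => hfab _ x⟩)

theorem comp_add_right (hf : RegularField f) (h : ℝ) : RegularField fun t x => f t (x + h) where
  measurable := hf.measurable.comp (by fun_prop : Measurable fun z : ℝ × ℝ => (z.1, z.2 + h))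
  bounded := let ⟨C, hC⟩ := hf.bounded; ⟨C, fun t x => hC t (x + h)⟩
  subseq s u hu := by
    obtain ⟨φ, hφ, h1⟩ := hf.subseq s u hu
    exact ⟨φ, hφ, (measurePreserving_add_right volume h).quasiMeasurePreserving.ae h1⟩

/-- Every sequence of times has a subsequence along which dominated convergence applies, and that is
enough for continuity. Through this lemma the field `subseq` makes spatial integrals continuous in
time. -/
theorem continuous_setIntegral_mul (hf : RegularField f) {ψ : ℝ → ℝ} {S : Set ℝ}
    (hψ : IntegrableOn ψ S) : Continuous fun t => ∫ x in S, ψ x * f t x := by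
  obtain ⟨C, hC⟩ := hf.bounded
  rw [continuous_iff_continuousAt]
  intro s
  refine tendsto_of_subseq_tendsto fun u hu => ?_
  obtain ⟨φ, hφ, h1⟩ := hf.subseq s u hu
  refine ⟨φ, tendsto_integral_of_dominated_convergence (fun x => ‖ψ x‖ * C) (fun n => ?_)
    (hψ.norm.mul_const C) (fun n => Eventually.of_forall fun x => ?_) ?_⟩
  · exact hψ.aestronglyMeasurable.mul (hf.measurable_section _).aestronglyMeasurable
  · rw [norm_mul]
    exact mul_le_mul_of_nonneg_left (hC _ x) (norm_nonneg _)
  · filter_upwards [ae_restrict_of_ae h1] with x hx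
    exact hx.const_mul _

theorem continuous_intervalIntegral (hf : RegularField f) (a b : ℝ) :
    Continuous fun t => ∫ x in a..b, f t x := by
  have h : ∀ S : Set ℝ, volume S ≠ ⊤ → Continuous fun t => ∫ x in S, f t x := fun S hS => by
    simpa using hf.continuous_setIntegral_mul (ψ := fun _ => 1) (S := S)
      (integrableOn_const hS)
  exact (h _ (by simp)).sub (h _ (by simp))

theorem continuous_expTail (hf : RegularField f) (hk : 0 < k) :
    Continuous (Function.uncurry fun t x => expTail k (f t) x) := by
  obtain ⟨C, hC⟩ := hf.bounded
  refine continuous_prod_of_continuous_lipschitzWith' _ (2 * C).toNNReal (fun t => ?_) fun x => ?_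
  · exact lipschitzWith_expTail hk (hf.measurable_section t) (hC t)
  · exact hf.continuous_setIntegral_mul (integrableOn_exp_mul_sub hk x x)

theorem expTail_field (hf : RegularField f) (hk : 0 < k) :
    RegularField fun t x => expTail k (f t) x := by
  refine of_continuous (hf.continuous_expTail hk) ?_
  obtain ⟨C, hC⟩ := hf.bounded
  exact ⟨C / k, fun t x => abs_expTail_le hk (hC t) x⟩

end RegularField

/-! ### Averages over short intervals -/

/-- The average of `g` over the interval between `x` and `x + h`. -/
noncomputable def boxAvg (h : ℝ) (g : ℝ → ℝ) (x : ℝ) : ℝ := h⁻¹ * ∫ y in x..x + h, g y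

theorem boxAvg_neg (h : ℝ) (g : ℝ → ℝ) (x : ℝ) : boxAvg (-h) g x = boxAvg h g (x - h) := by
  rw [boxAvg, boxAvg, sub_add_cancel, intervalIntegral.integral_symm, inv_neg, ← sub_eq_add_neg]
  ring

section boxAvg

variable {g : ℝ → ℝ} {h C : ℝ}

theorem boxAvg_mem_Icc (hh : 0 < h) (hg : LocallyIntegrable g volume) {x : ℝ}
    (h0 : ∀ᵐ x, 0 ≤ g x) (hC : ∀ᵐ x, g x ≤ C) :
    boxAvg h g x ∈ Icc 0 C := by
  have hi : IntervalIntegrable g volume x (x + h) :=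
    (hg.integrableOn_isCompact isCompact_uIcc).intervalIntegrable
  have hx : x ≤ x + h := by linarith
  constructor
  · exact mul_nonneg (by positivity)
      (intervalIntegral.integral_nonneg_of_ae hx (by filter_upwards [h0] with y hy using hy))
  · have := intervalIntegral.integral_mono_ae hx hi
      (intervalIntegrable_const (c := C)) (by filter_upwards [hC] with y hy using hy)
    rw [intervalIntegral.integral_const, smul_eq_mul, add_sub_cancel_left] at this
    calc boxAvg h g x ≤ h⁻¹ * (h * C) := mul_le_mul_of_nonneg_left this (by positivity)
      _ = C := by field_simp

theorem boxAvg_eq (hg : LocallyIntegrable g volume) (x : ℝ) :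
    boxAvg h g x = h⁻¹ * ((∫ y in 0..x + h, g y) - ∫ y in 0..x, g y) := by
  have hi : ∀ a b, IntervalIntegrable g volume a b := fun a b =>
    (hg.integrableOn_isCompact isCompact_uIcc).intervalIntegrable
  rw [boxAvg, intervalIntegral.integral_interval_sub_left (hi _ _) (hi _ _)]

theorem tendsto_boxAvg (hg : LocallyIntegrable g volume) {x : ℝ} {u : ℕ → ℝ}
    (hx : HasDerivAt (fun x => ∫ y in 0..x, g y) (g x) x) (hu : Tendsto u atTop (𝓝[≠] 0)) :
    Tendsto (fun n => boxAvg (u n) g x) atTop (𝓝 (g x)) := by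
  refine (hx.tendsto_slope_zero.comp hu).congr fun n => ?_
  rw [boxAvg_eq hg]; rfl

theorem ae_tendsto_boxAvg (hg : LocallyIntegrable g volume) {u : ℕ → ℝ}
    (hu : Tendsto u atTop (𝓝[≠] 0)) :
    ∀ᵐ x, Tendsto (fun n => boxAvg (u n) g x) atTop (𝓝 (g x)) := by
  filter_upwards [LocallyIntegrable.ae_hasDerivAt_integral hg] with x hx
  exact tendsto_boxAvg hg (hx 0) hu

/-- The reason for averaging over intervals instead of using smooth mollifiers: the derivative is
exactly the difference quotient that also appears in the averaged continuity equation. -/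
theorem ae_hasDerivAt_boxAvg (hg : LocallyIntegrable g volume) :
    ∀ᵐ x, HasDerivAt (boxAvg h g) (h⁻¹ * (g (x + h) - g x)) x := by
  have h1 := LocallyIntegrable.ae_hasDerivAt_integral hg
  filter_upwards [h1, (measurePreserving_add_right volume h).quasiMeasurePreserving.ae h1]
    with x h1 h2
  rw [show boxAvg h g = fun x => h⁻¹ * ((∫ y in 0..x + h, g y) - ∫ y in 0..x, g y) from
    funext (boxAvg_eq hg)]
  exact (((h2 0).comp_add_const x h).sub (h1 0)).const_mul h⁻¹

theorem lipschitzWith_boxAvg (hg : LocallyIntegrable g volume) (hb : ∀ᵐ x, |g x| ≤ C) :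
    LipschitzWith (|h⁻¹| * (2 * C)).toNNReal (boxAvg h g) := by
  have hi : ∀ a b, IntervalIntegrable g volume a b := fun a b =>
    (hg.integrableOn_isCompact isCompact_uIcc).intervalIntegrable
  have key : ∀ x y, |∫ z in x..y, g z| ≤ C * |y - x| := fun x y => by
    simpa using! intervalIntegral.norm_integral_le_of_norm_le_const_ae (f := g) (C := C)
      (a := x) (b := y) (by filter_upwards [hb] with z hz _ using hz)
  obtain ⟨z, hz⟩ := hb.exists
  have hC : 0 ≤ C := (abs_nonneg _).trans hz
  refine LipschitzWith.of_dist_le_mul fun x y => ?_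
  rw [Real.coe_toNNReal _ (by positivity), Real.dist_eq, Real.dist_eq, boxAvg_eq hg, boxAvg_eq hg]
  have e : h⁻¹ * ((∫ y in 0..x + h, g y) - ∫ y in 0..x, g y) -
      h⁻¹ * ((∫ z in 0..y + h, g z) - ∫ y in 0..y, g y) =
      h⁻¹ * ((∫ z in (y + h)..(x + h), g z) - ∫ z in y..x, g z) := by
    rw [← intervalIntegral.integral_interval_sub_left (hi 0 (x + h)) (hi 0 (y + h)),
      ← intervalIntegral.integral_interval_sub_left (hi 0 x) (hi 0 y)]
    ring
  rw [e, abs_mul, mul_assoc]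
  refine mul_le_mul_of_nonneg_left ?_ (abs_nonneg _)
  have h1 := key (y + h) (x + h)
  rw [show x + h - (y + h) = x - y by ring] at h1
  exact (abs_sub _ _).trans (by linarith [key y x])

end boxAvg

theorem tendsto_one_div_add_one_nhdsNE : Tendsto (fun n : ℕ => 1 / ((n : ℝ) + 1)) atTop (𝓝[≠] 0) :=
  tendsto_nhdsWithin_iff.2 ⟨tendsto_one_div_add_atTop_nhds_zero_nat,
    Eventually.of_forall fun _ => (Nat.one_div_pos_of_nat (α := ℝ)).ne'⟩

theorem RegularField.continuous_boxAvg {f : ℝ → ℝ → ℝ} (hf : RegularField f) (h : ℝ) :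
    Continuous (Function.uncurry fun t x => boxAvg h (f t) x) := by
  obtain ⟨C, hC⟩ := hf.bounded
  refine continuous_prod_of_continuous_lipschitzWith' _ (|h⁻¹| * (2 * C)).toNNReal
    (fun t => ?_) fun x => ?_
  · exact lipschitzWith_boxAvg (locallyIntegrable_of_bound (hf.measurable_section t) (hC t))
      (Eventually.of_forall (hC t))
  · exact (hf.continuous_intervalIntegral x (x + h)).const_mul h⁻¹

/-! ### A Borel representative defined for all times -/

/-- Local convergence in `L¹` gives an almost everywhere convergent subsequence. -/
theorem exists_subseq_ae_tendsto_of_locL1 {v : ℕ → ℝ → ℝ} {w : ℝ → ℝ}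
    (hv : ∀ n, LocallyIntegrable (v n) volume) (hw : LocallyIntegrable w volume)
    (h : ∀ R : ℝ, Tendsto (fun n => ∫ x in Icc (-R) R, |v n x - w x|) atTop (𝓝 0)) :
    ∃ φ : ℕ → ℕ, StrictMono φ ∧ ∀ᵐ x, Tendsto (fun n => v (φ n) x) atTop (𝓝 (w x)) := by
  -- The window and the accuracy grow together: error below 2^{-n} on [-n, n]. One subsequence then
  -- serves all bounded intervals, with summable errors on each.
  obtain ⟨φ, hφ, hφ'⟩ := extraction_forall_of_eventually (P := fun n m =>
    ∫ x in Icc (-(n : ℝ)) n, |v m x - w x| < (1 / 2) ^ n) fun n =>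
      (h n).eventually_lt_const (by positivity)
  have hint : ∀ n (R : ℝ), IntegrableOn (fun x => v n x - w x) (Icc (-R) R) := fun n R =>
    ((hv n).integrableOn_isCompact isCompact_Icc).sub (hw.integrableOn_isCompact isCompact_Icc)
  refine ⟨φ, hφ, ?_⟩
  have key : ∀ R : ℕ, ∀ᵐ x, x ∈ Icc (-(R : ℝ)) R →
      Tendsto (fun n => v (φ n) x) atTop (𝓝 (w x)) := by
    intro R
    rw [← ae_restrict_iff' measurableSet_Icc]
    -- The shift by R ensures that every window in the sum contains [-R, R].
    have hfin : ∑' n, ∫⁻ x in Icc (-(R : ℝ)) R, ‖v (φ (n + R)) x - w x‖ₑ ≠ ⊤ := by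
      refine ne_top_of_le_ne_top (b := ∑' n : ℕ, ENNReal.ofReal ((1 / 2) ^ n)) ?_
        (ENNReal.tsum_le_tsum fun n => ?_)
      · exact summable_geometric_two.tsum_ofReal_ne_top
      · have h1 : ∫⁻ x in Icc (-(R : ℝ)) R, ‖v (φ (n + R)) x - w x‖ₑ ≤
            ∫⁻ x in Icc (-((n + R : ℕ) : ℝ)) (n + R : ℕ), ‖v (φ (n + R)) x - w x‖ₑ := by
          refine lintegral_mono_set (Icc_subset_Icc ?_ ?_) <;> push_cast <;> linarith [n.cast_nonneg (α := ℝ)]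
        refine h1.trans ?_
        rw [← ofReal_integral_norm_eq_lintegral_enorm (hint _ _)]
        refine ENNReal.ofReal_le_ofReal ((hφ' (n + R)).le.trans ?_)
        exact pow_le_pow_of_le_one (by norm_num) (by norm_num) (by omega)
    rw [← lintegral_tsum fun n => (hint _ _).aestronglyMeasurable.enorm] at hfin
    filter_upwards [ae_lt_top' (AEMeasurable.tsum fun n =>
      (hint _ _).aestronglyMeasurable.enorm) hfin] with x hx
    have h0 := ENNReal.tendsto_atTop_zero_of_tsum_ne_top hx.ne
    rw [← tendsto_add_atTop_iff_nat R, tendsto_iff_edist_tendsto_0]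
    simpa [edist_eq_enorm_sub] using h0
  filter_upwards [ae_all_iff.2 key] with x hx
  obtain ⟨R, hR⟩ := exists_nat_ge |x|
  exact hx R (abs_le.1 hR)

theorem ContinuousIntoLocL1.exists_regularField {T C : ℝ} {q : ℝ → ℝ → ℝ} (hT : 0 < T)
    (hq : ContinuousIntoLocL1 T q) (h0 : ∀ t ∈ Icc 0 T, ∀ᵐ x, 0 ≤ q t x)
    (hC : ∀ t ∈ Icc 0 T, ∀ᵐ x, q t x ≤ C) :
    ∃ r : ℝ → ℝ → ℝ, RegularField r ∧ (∀ t x, r t x ∈ Icc 0 C) ∧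
      (∀ t, r t = r (max 0 (min T t))) ∧ (∀ t ∈ Icc 0 T, q t =ᵐ[volume] r t) ∧
      ∀ t ∈ Icc 0 T, Continuous (q t) → r t = q t := by
  -- Clamping time to [0,T] extends the density to all real times and preserves continuity in time.
  set π : ℝ → ℝ := fun t => max 0 (min T t) with hπ
  have hπmem : ∀ t, π t ∈ Icc 0 T := fun t => ⟨le_max_left _ _, max_le hT.le (min_le_left _ _)⟩
  have hπeq : ∀ t ∈ Icc 0 T, π t = t := fun t ht => by
    simp only [hπ, min_eq_right ht.2, max_eq_right ht.1]
  have hπc : Continuous π := by fun_prop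
  have hloc : ∀ t, LocallyIntegrable (q (π t)) volume := fun t => hq.1 _ (hπmem t)
  have hbd : ∀ t, ∀ᵐ x, |q (π t) x| ≤ C := fun t => by
    filter_upwards [h0 _ (hπmem t), hC _ (hπmem t)] with x h1 h2
    rwa [abs_of_nonneg h1]
  have hlim : ∀ (s : ℝ) (R : ℝ), Tendsto (fun t => ∫ x in Icc (-R) R, |q (π t) x - q (π s) x|)
      (𝓝 s) (𝓝 0) := fun s R =>
    (hq.2 _ (hπmem s) R).comp (tendsto_nhdsWithin_iff.2
      ⟨hπc.tendsto s, Eventually.of_forall hπmem⟩)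
  set A : ℕ → ℝ × ℝ → ℝ := fun n z => boxAvg (1 / ((n : ℝ) + 1)) (q (π z.1)) z.2 with hA
  have hAc : ∀ n, Continuous (A n) := by
    intro n
    refine continuous_prod_of_continuous_lipschitzWith' _
      (|(1 / ((n : ℝ) + 1))⁻¹| * (2 * C)).toNNReal
      (fun t => lipschitzWith_boxAvg (hloc t) (hbd t)) fun x => ?_
    refine Continuous.const_mul ?_ _
    rw [continuous_iff_continuousAt]
    intro s
    obtain ⟨R, hR⟩ : ∃ R : ℝ, uIoc x (x + 1 / ((n : ℝ) + 1)) ⊆ Icc (-R) R := by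
      refine ⟨|x| + |x + 1 / ((n : ℝ) + 1)|, fun y hy => ?_⟩
      have := uIoc_subset_uIcc hy
      rw [uIcc, mem_Icc] at this
      have h1 := abs_le.1 (le_refl |x|)
      have h2 := abs_le.1 (le_refl |x + 1 / ((n : ℝ) + 1)|)
      constructor
      · refine le_trans ?_ this.1
        refine le_inf ?_ ?_ <;> linarith [abs_nonneg x, abs_nonneg (x + 1 / ((n : ℝ) + 1))]
      · refine this.2.trans ?_
        refine sup_le ?_ ?_ <;> linarith [abs_nonneg x, abs_nonneg (x + 1 / ((n : ℝ) + 1))]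
    have hi : ∀ t a b, IntervalIntegrable (q (π t)) volume a b := fun t a b =>
      ((hloc t).integrableOn_isCompact isCompact_uIcc).intervalIntegrable
    refine tendsto_iff_dist_tendsto_zero.2 (squeeze_zero (fun _ => dist_nonneg) (fun t => ?_)
      (hlim s R))
    rw [Real.dist_eq, ← intervalIntegral.integral_sub (hi _ _ _) (hi _ _ _)]
    refine (intervalIntegral.norm_integral_le_integral_norm_uIoc (f := fun y =>
      q (π t) y - q (π s) y)).trans ?_
    refine setIntegral_mono_set ?_ (Eventually.of_forall fun _ => norm_nonneg _) hR.eventuallyLE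
    exact (((hloc t).integrableOn_isCompact isCompact_Icc).sub
      ((hloc s).integrableOn_isCompact isCompact_Icc)).norm
  have hAmem : ∀ n z, A n z ∈ Icc 0 C := fun n z =>
    boxAvg_mem_Icc Nat.one_div_pos_of_nat (hloc z.1) (h0 _ (hπmem z.1)) (hC _ (hπmem z.1))
  -- The averages are jointly continuous, so their limsup is Borel on the plane. It agrees with the
  -- density at Lebesgue points, hence everywhere on a slice that is continuous in x.
  set r : ℝ → ℝ → ℝ := fun t x => limsup (fun n => A n (t, x)) atTop with hr
  have hbdd : ∀ z, IsBoundedUnder (· ≤ ·) atTop fun n => A n z := fun z =>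
    ⟨C, eventually_map.2 (Eventually.of_forall fun n => (hAmem n z).2)⟩
  have hcobdd : ∀ z, IsCoboundedUnder (· ≤ ·) atTop fun n => A n z := fun z =>
    IsBoundedUnder.isCoboundedUnder_le
      ⟨0, eventually_map.2 (Eventually.of_forall fun n => (hAmem n z).1)⟩
  have hrmem : ∀ t x, r t x ∈ Icc 0 C := fun t x =>
    ⟨le_limsup_of_le (hbdd _) fun b hb =>
      let ⟨n, hn⟩ := hb.exists; (hAmem n _).1.trans hn,
    limsup_le_of_le (hcobdd _) (Eventually.of_forall fun n => (hAmem n _).2)⟩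
  have hrae : ∀ t, q (π t) =ᵐ[volume] r t := fun t => by
    filter_upwards [ae_tendsto_boxAvg (hloc t) tendsto_one_div_add_one_nhdsNE] with x hx
    exact hx.limsup_eq.symm
  refine ⟨r, ⟨?_, ⟨C, fun t x => ?_⟩, fun s u hu => ?_⟩, hrmem, fun t => ?_,
    fun t ht => ?_, fun t ht hc => ?_⟩
  · exact Measurable.limsup fun n => (hAc n).measurable
  · rw [abs_of_nonneg (hrmem t x).1]; exact (hrmem t x).2
  · obtain ⟨φ, hφ, h1⟩ := exists_subseq_ae_tendsto_of_locL1 (v := fun n => q (π (u n)))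
      (fun n => hloc _) (hloc s) fun R => (hlim s R).comp hu
    refine ⟨φ, hφ, ?_⟩
    filter_upwards [h1, hrae s, ae_all_iff.2 fun n => hrae (u (φ n))] with x h1 h2 h3
    rw [← h2]
    exact h1.congr h3
  · have : π (max 0 (min T t)) = π t := hπeq _ (hπmem t)
    simp only [hr, hA, this]
  · simpa only [hπeq t ht] using hrae t
  · ext x
    have := tendsto_boxAvg (hc.locallyIntegrable (μ := volume))
      (hc.integral_hasStrictDerivAt 0 x).hasDerivAt tendsto_one_div_add_one_nhdsNE
    simp only [hr, hA, hπeq t ht]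
    exact this.limsup_eq

/-! ### Renormalization of the continuity equation -/

theorem tendsto_expTail {k C : ℝ} {g : ℕ → ℝ → ℝ} {g₀ : ℝ → ℝ} (hk : 0 < k)
    (hm : ∀ n, Measurable (g n)) (hb : ∀ n y, |g n y| ≤ C)
    (h : ∀ᵐ y, Tendsto (fun n => g n y) atTop (𝓝 (g₀ y))) (x : ℝ) :
    Tendsto (fun n => expTail k (g n) x) atTop (𝓝 (expTail k g₀ x)) := by
  refine tendsto_integral_of_dominated_convergence (fun y => Real.exp (k * (x - y)) * C)
    (fun n => ?_) ((integrableOn_exp_mul_sub hk x x).mul_const C)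
    (fun n => Eventually.of_forall fun y => ?_) ?_
  · exact (Measurable.mul (by fun_prop) (hm n)).aestronglyMeasurable
  · rw [norm_mul, Real.norm_eq_abs, abs_of_pos (Real.exp_pos _)]
    exact mul_le_mul_of_nonneg_left (hb n y) (Real.exp_pos _).le
  · filter_upwards [ae_restrict_of_ae h] with y hy
    exact hy.const_mul _

theorem RegularField.setIntegral_mul_intervalIntegral {G : ℝ → ℝ → ℝ} (hG : RegularField G)
    {ψ : ℝ → ℝ} {S : Set ℝ} (hψ : IntegrableOn ψ S) {t : ℝ} (ht : 0 ≤ t) :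
    ∫ x in S, ψ x * ∫ τ in 0..t, G τ x = ∫ τ in 0..t, ∫ x in S, ψ x * G τ x := by
  obtain ⟨C, hC⟩ := hG.bounded
  have hint : Integrable (Function.uncurry fun x τ => ψ x * G τ x)
      ((volume.restrict S).prod (volume.restrict (Ioc 0 t))) := by
    have h1 : Integrable (fun z : ℝ × ℝ => ψ z.1 * C)
        ((volume.restrict S).prod (volume.restrict (Ioc 0 t))) :=
      Integrable.mul_prod hψ (integrable_const C)
    refine h1.mono ?_ (Eventually.of_forall fun z => ?_)
    · exact hψ.aestronglyMeasurable.comp_fst.mul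
        (hG.measurable.comp measurable_swap).aestronglyMeasurable
    · simp only [Function.uncurry, norm_mul, Real.norm_eq_abs]
      exact mul_le_mul_of_nonneg_left ((hC _ _).trans (le_abs_self C)) (abs_nonneg _)
  simp only [intervalIntegral.integral_of_le ht, ← integral_const_mul]
  exact integral_integral_swap hint

theorem RegularField.expTail_intervalIntegral {G : ℝ → ℝ → ℝ} {k : ℝ} (hG : RegularField G)
    (hk : 0 < k) (x : ℝ) {t : ℝ} (ht : 0 ≤ t) :
    expTail k (fun y => ∫ τ in 0..t, G τ y) x = ∫ τ in 0..t, expTail k (G τ) x :=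
  hG.setIntegral_mul_intervalIntegral (integrableOn_exp_mul_sub hk x x) ht

theorem LipschitzWith.mul_of_bounded {f g : ℝ → ℝ} {K L : NNReal} {M N : ℝ}
    (hf : LipschitzWith K f) (hg : LipschitzWith L g) (hfb : ∀ x, |f x| ≤ M)
    (hgb : ∀ x, |g x| ≤ N) : LipschitzWith (M * L + N * K).toNNReal fun x => f x * g x := by
  have hM : 0 ≤ M := (abs_nonneg _).trans (hfb 0)
  have hN : 0 ≤ N := (abs_nonneg _).trans (hgb 0)
  refine LipschitzWith.of_dist_le_mul fun x y => ?_
  rw [Real.coe_toNNReal _ (by positivity), Real.dist_eq,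
    show f x * g x - f y * g y = f x * (g x - g y) + g y * (f x - f y) by ring]
  have h1 := hf.dist_le_mul x y
  have h2 := hg.dist_le_mul x y
  rw [Real.dist_eq] at h1 h2
  refine (abs_add_le _ _).trans ?_
  rw [abs_mul, abs_mul, add_mul, mul_assoc, mul_assoc]
  exact add_le_add (mul_le_mul (hfb x) h2 (abs_nonneg _) hM)
    (mul_le_mul (hgb y) h1 (abs_nonneg _) hN)

/-- The continuity equation `∂ₜ q + ∂ₓ (b q) = 0` on `(0,T) × ℝ`, in integrated form, for a bounded
density `q` and a velocity field `b` that is Lipschitz in space with derivative `B`. -/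
structure ContinuityEquation (T C : ℝ) (K : NNReal) (q b B : ℝ → ℝ → ℝ) : Prop where
  density : RegularField q
  velocity : RegularField b
  slope : RegularField B
  mem_Icc : ∀ t x, q t x ∈ Icc 0 C
  lipschitz : ∀ t, LipschitzWith K (b t)
  hasDerivAt : ∀ t, ∀ᵐ x, HasDerivAt (b t) (B t x) x
  balance : ∀ h > 0, ∀ t ∈ Icc 0 T, ∀ᵐ x, (∫ y in x..x + h, q t y) - ∫ y in x..x + h, q 0 y =
    -∫ τ in 0..t, (b τ (x + h) * q τ (x + h) - b τ x * q τ x)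

/-- The time derivative of `expTail k (f t) x` for a renormalization `f` of the density, with source
term `G`. -/
noncomputable def renormalizedFlux (k : ℝ) (b B f G : ℝ → ℝ → ℝ) (τ x : ℝ) : ℝ :=
  b τ x * f τ x - k * expTail k (fun y => b τ y * f τ y) x +
    expTail k (fun y => B τ y * f τ y) x - expTail k (G τ) x

theorem regularField_renormalizedFlux {k : ℝ} {b B f G : ℝ → ℝ → ℝ} (hk : 0 < k)
    (hb : RegularField b) (hB : RegularField B) (hf : RegularField f) (hG : RegularField G) :
    RegularField (renormalizedFlux k b B f G) :=
  ((((hb.mul hf).sub (((hb.mul hf).expTail_field hk).const_mul k)).add ((hB.mul hf).expTail_field hk)).sub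
    (hG.expTail_field hk))

/-- Dominated convergence, used for both limits h → 0 and δ → 0. The flux contains the local value
f(τ,x), so convergence at the given x is needed for almost every τ. The source enters only through
its tail, and only the tail is required to converge: for h → 0 the source contains a translate of
the density, which need not converge pointwise. -/
theorem tendsto_integral_renormalizedFlux {k M t x : ℝ} {b B f₀ G₀ : ℝ → ℝ → ℝ}
    {f G : ℕ → ℝ → ℝ → ℝ} (hk : 0 < k) (hb : RegularField b) (hB : RegularField B)
    (hf : ∀ n, RegularField (f n)) (hG : ∀ n, RegularField (G n))
    (hfM : ∀ n τ y, |f n τ y| ≤ M) (hGM : ∀ n τ y, |G n τ y| ≤ M)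
    (hfx : ∀ᵐ τ, Tendsto (fun n => f n τ x) atTop (𝓝 (f₀ τ x)))
    (hfy : ∀ τ, ∀ᵐ y, Tendsto (fun n => f n τ y) atTop (𝓝 (f₀ τ y)))
    (hGx : ∀ τ, Tendsto (fun n => expTail k (G n τ) x) atTop (𝓝 (expTail k (G₀ τ) x))) :
    Tendsto (fun n => ∫ τ in 0..t, renormalizedFlux k b B (f n) (G n) τ x) atTop
      (𝓝 (∫ τ in 0..t, renormalizedFlux k b B f₀ G₀ τ x)) := by
  obtain ⟨N, hN⟩ := hb.bounded
  obtain ⟨N', hN'⟩ := hB.bounded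
  have hbf : ∀ n τ y, |b τ y * f n τ y| ≤ N * M := fun n τ y => by
    rw [abs_mul]
    exact mul_le_mul (hN τ y) (hfM n τ y) (abs_nonneg _) ((abs_nonneg _).trans (hN τ y))
  have hBf : ∀ n τ y, |B τ y * f n τ y| ≤ N' * M := fun n τ y => by
    rw [abs_mul]
    exact mul_le_mul (hN' τ y) (hfM n τ y) (abs_nonneg _) ((abs_nonneg _).trans (hN' τ y))
  refine intervalIntegral.tendsto_integral_filter_of_dominated_convergence
    (fun _ => N * M + k * (N * M / k) + N' * M / k + M / k)
    (Eventually.of_forall fun n => ?_) (Eventually.of_forall fun n => ?_)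
    intervalIntegrable_const ?_
  · exact ((regularField_renormalizedFlux hk hb hB (hf n)
      (hG n)).measurable_time x).aestronglyMeasurable
  · refine Eventually.of_forall fun τ _ => ?_
    rw [Real.norm_eq_abs, renormalizedFlux]
    refine (abs_sub _ _).trans (add_le_add ((abs_add_le _ _).trans (add_le_add
      ((abs_sub _ _).trans (add_le_add (hbf n τ x) ?_)) (abs_expTail_le hk (hBf n τ) x)))
      (abs_expTail_le hk (hGM n τ) x))
    rw [abs_mul, abs_of_pos hk]
    exact mul_le_mul_of_nonneg_left (abs_expTail_le hk (hbf n τ) x) hk.le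
  · filter_upwards [hfx] with τ hτ _
    have h1 := tendsto_expTail hk
      (fun n => (hb.measurable_section τ).mul ((hf n).measurable_section τ)) (fun n => hbf n τ)
      (g₀ := fun y => b τ y * f₀ τ y) (by
        filter_upwards [hfy τ] with y hy using hy.const_mul _) x
    have h2 := tendsto_expTail hk
      (fun n => (hB.measurable_section τ).mul ((hf n).measurable_section τ)) (fun n => hBf n τ)
      (g₀ := fun y => B τ y * f₀ τ y) (by
        filter_upwards [hfy τ] with y hy using hy.const_mul _) x
    exact (((hτ.const_mul _).sub (h1.const_mul k)).add h2).sub (hGx τ)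

/-! ### Renormalization by averaging over intervals, then for powers -/

namespace ContinuityEquation

variable {T C k : ℝ} {K : NNReal} {q b B : ℝ → ℝ → ℝ}

theorem abs_le (H : ContinuityEquation T C K q b B) (t x : ℝ) : |q t x| ≤ C := by
  rw [abs_of_nonneg (H.mem_Icc t x).1]; exact (H.mem_Icc t x).2

theorem locallyIntegrable (H : ContinuityEquation T C K q b B) (t : ℝ) :
    LocallyIntegrable (q t) volume :=
  locallyIntegrable_of_bound (H.density.measurable_section t) (H.abs_le t)

theorem boxAvg_mem (H : ContinuityEquation T C K q b B) {h : ℝ} (hh : 0 < h) (t x : ℝ) :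
    boxAvg h (q t) x ∈ Icc 0 C :=
  boxAvg_mem_Icc hh (H.locallyIntegrable t) (Eventually.of_forall fun x => (H.mem_Icc t x).1)
    (Eventually.of_forall fun x => (H.mem_Icc t x).2)

theorem regularField_boxAvg (H : ContinuityEquation T C K q b B) {h : ℝ} (hh : 0 < h) :
    RegularField fun t x => boxAvg h (q t) x :=
  RegularField.of_continuous (H.density.continuous_boxAvg h) ⟨C, fun t x => by
    rw [abs_of_nonneg (H.boxAvg_mem hh t x).1]; exact (H.boxAvg_mem hh t x).2⟩

theorem regularField_flux (H : ContinuityEquation T C K q b B) (h : ℝ) :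
    RegularField fun t x => -h⁻¹ * (b t (x + h) * q t (x + h) - b t x * q t x) :=
  (((H.velocity.mul H.density).comp_add_right h).sub (H.velocity.mul H.density)).const_mul _

/-- The exceptional null set of `balance` depends on t. Both sides are continuous in t, so it
suffices to discard the null sets of countably many times, the clamped rationals. -/
theorem ae_forall_boxAvg_eq (H : ContinuityEquation T C K q b B) (hT : 0 ≤ T) {h : ℝ}
    (hh : 0 < h) :
    ∀ᵐ x, ∀ t ∈ Icc 0 T, boxAvg h (q t) x = boxAvg h (q 0) x +
      ∫ τ in 0..t, -h⁻¹ * (b τ (x + h) * q τ (x + h) - b τ x * q τ x) := by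
  obtain ⟨M, hM⟩ := (H.regularField_flux h).bounded
  set π : ℝ → ℝ := fun t => max 0 (min T t) with hπ
  have hπmem : ∀ t, π t ∈ Icc 0 T := fun t => ⟨le_max_left _ _, max_le hT (min_le_left _ _)⟩
  have hπc : Continuous π := by fun_prop
  filter_upwards [ae_all_iff.2 fun r : ℚ => H.balance h hh (π r) (hπmem r)] with x hx t ht
  have h1 : Continuous fun t => boxAvg h (q (π t)) x :=
    (H.density.continuous_boxAvg h).comp (hπc.prodMk continuous_const)
  have h2 : Continuous fun t => boxAvg h (q 0) x +
      ∫ τ in 0..π t, -h⁻¹ * (b τ (x + h) * q τ (x + h) - b τ x * q τ x) :=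
    ((lipschitzWith_intervalIntegral_of_bound ((H.regularField_flux h).measurable_time x)
      (fun τ => hM τ x) 0).continuous.comp hπc).const_add _
  have h3 := Rat.denseRange_cast.equalizer h1 h2 (by
    ext r
    simp only [Function.comp, boxAvg, intervalIntegral.integral_const_mul]
    linear_combination h⁻¹ * hx r)
  have := congrFun h3 t
  simpa only [hπ, min_eq_right ht.2, max_eq_right ht.1] using this

/-- The renormalized equation for the box averages of the density. -/
theorem expTail_boxAvg_sub (H : ContinuityEquation T C K q b B) (hT : 0 ≤ T) (hk : 0 < k)
    {β β' : ℝ → ℝ} (hβm : Measurable β) (hβ'm : Measurable β')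
    (hβ : ∀ r ∈ Icc 0 C, HasDerivAt β (β' r) r) (hβ' : ContinuousOn β' (Icc 0 C))
    {h : ℝ} (hh : 0 < h) (x : ℝ) {t : ℝ} (ht : t ∈ Icc 0 T) :
    expTail k (fun y => β (boxAvg h (q t) y)) x - expTail k (fun y => β (boxAvg h (q 0) y)) x =
      ∫ τ in 0..t, renormalizedFlux k b B (fun τ y => β (boxAvg h (q τ) y))
        (fun τ y => β' (boxAvg h (q τ) y) * q τ (y + h) * (h⁻¹ * (b τ (y + h) - b τ y))) τ x := by
  have hQ := H.regularField_boxAvg hh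
  have hβc : ContinuousOn β (Icc 0 C) := fun r hr => (hβ r hr).continuousAt.continuousWithinAt
  have hβQ := hQ.comp hβm hβc (H.boxAvg_mem hh)
  have hβ'Q := hQ.comp hβ'm hβ' (H.boxAvg_mem hh)
  have hq' := H.density.comp_add_right h
  have hDb := ((H.velocity.comp_add_right h).sub H.velocity).const_mul h⁻¹
  have hDq := (hq'.sub H.density).const_mul h⁻¹
  obtain ⟨L, hL⟩ := isCompact_Icc.exists_bound_of_continuousOn hβ'
  obtain ⟨M, hM⟩ := (H.regularField_flux h).bounded
  obtain ⟨N, hN⟩ := hβQ.bounded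
  obtain ⟨Nb, hNb⟩ := H.velocity.bounded
  have hG := hβ'Q.mul (H.regularField_flux h)
  have step1 : expTail k (fun y => β (boxAvg h (q t) y)) x -
      expTail k (fun y => β (boxAvg h (q 0) y)) x = ∫ τ in 0..t, expTail k (fun y =>
        β' (boxAvg h (q τ) y) * (-h⁻¹ * (b τ (y + h) * q τ (y + h) - b τ y * q τ y))) x := by
    rw [← expTail_sub hk (hβQ.measurable_section t) (hβQ.measurable_section 0) (hN t) (hN 0),
      ← hG.expTail_intervalIntegral hk x ht.1]
    refine expTail_congr_ae ?_ x
    filter_upwards [H.ae_forall_boxAvg_eq hT hh] with y hy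
    have := comp_indefinite_integral_sub (f₀ := boxAvg h (q 0) y)
      ((H.regularField_flux h).measurable_time y) (fun τ => hM τ y) hβ hL
      (fun s hs => by rw [← hy s hs]; exact H.boxAvg_mem hh s y) ht
    rw [← hy t ht] at this
    rw [this]
    refine intervalIntegral.integral_congr fun τ hτ => ?_
    rw [uIcc_of_le ht.1] at hτ
    simp only [← hy τ ⟨hτ.1, hτ.2.trans ht.2⟩]
  rw [step1]
  congr 1
  ext τ
  have hLβ : LipschitzOnWith L.toNNReal β (Icc 0 C) := by
    refine (convex_Icc 0 C).lipschitzOnWith_of_nnnorm_hasDerivWithin_le (f' := β')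
      (fun r hr => (hβ r hr).hasDerivWithinAt) fun r hr => ?_
    rw [← NNReal.coe_le_coe, coe_nnnorm]
    exact (hL r hr).trans (Real.le_coe_toNNReal L)
  have hLQ : LipschitzWith _ fun y => β (boxAvg h (q τ) y) :=
    lipschitzOnWith_univ.1 (hLβ.comp (lipschitzOnWith_univ.2 (lipschitzWith_boxAvg
      (H.locallyIntegrable τ) (Eventually.of_forall (H.abs_le τ))))
      fun y _ => H.boxAvg_mem hh τ y)
  have hP1 := H.slope.mul hβQ
  have hP2 := (H.velocity.mul hβ'Q).mul hDq
  have hP3 := (hβ'Q.mul hq').mul hDb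
  obtain ⟨M1, hM1⟩ := hP1.bounded
  obtain ⟨M2, hM2⟩ := hP2.bounded
  obtain ⟨M3, hM3⟩ := hP3.bounded
  obtain ⟨M12, hM12⟩ := (hP1.add hP2).bounded
  obtain ⟨M4, hM4⟩ := (H.velocity.mul hβQ).bounded
  have hibp := expTail_of_ae_hasDerivAt hk
    ((H.lipschitz τ).mul_of_bounded hLQ (hNb τ) (hN τ)) (hM4 τ)
    ((hP1.add hP2).measurable_section τ) (hM12 τ) (by
      filter_upwards [H.hasDerivAt τ, ae_hasDerivAt_boxAvg (h := h) (H.locallyIntegrable τ)]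
        with y h1 h2
      refine (h1.mul ((hβ _ (H.boxAvg_mem hh τ y)).comp y h2)).congr_deriv ?_
      simp only [Function.comp]
      ring) x
  rw [expTail_add hk (hP1.measurable_section τ) (hP2.measurable_section τ) (hM1 τ) (hM2 τ)] at hibp
  -- The discrete product rule b(y+h)q(y+h) - b(y)q(y) = b(y)(q(y+h) - q(y)) + q(y+h)(b(y+h) -
  -- b(y)). The first part, times β' of the average, is b times the y-derivative of β of the average
  -- and is absorbed by the integration by parts `hibp`; the second is the source.
  have hsplit : expTail k (fun y => β' (boxAvg h (q τ) y) *
        (-h⁻¹ * (b τ (y + h) * q τ (y + h) - b τ y * q τ y))) x =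
      -1 * expTail k (fun y => b τ y * β' (boxAvg h (q τ) y) *
        (h⁻¹ * (q τ (y + h) - q τ y))) x -
      expTail k (fun y => β' (boxAvg h (q τ) y) * q τ (y + h) *
        (h⁻¹ * (b τ (y + h) - b τ y))) x := by
    rw [← expTail_const_mul, ← expTail_sub hk ((hP2.const_mul (-1)).measurable_section τ)
      (hP3.measurable_section τ) (C₁ := M2) (fun y => by simpa using hM2 τ y) (hM3 τ)]
    congr 1; ext y; ring
  rw [hsplit, renormalizedFlux]
  linear_combination -hibp

/-- The renormalized continuity equation for `C¹` renormalizations. -/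
theorem ae_expTail_comp_sub (H : ContinuityEquation T C K q b B) (hT : 0 ≤ T) (hk : 0 < k)
    {β β' : ℝ → ℝ} (hβm : Measurable β) (hβ'm : Measurable β')
    (hβ : ∀ r ∈ Icc 0 C, HasDerivAt β (β' r) r) (hβ' : ContinuousOn β' (Icc 0 C)) :
    ∀ᵐ x, ∀ t ∈ Icc 0 T, expTail k (fun y => β (q t y)) x - expTail k (fun y => β (q 0 y)) x =
      ∫ τ in 0..t, renormalizedFlux k b B (fun τ y => β (q τ y))
        (fun τ y => β' (q τ y) * q τ y * B τ y) τ x := by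
  set ε : ℕ → ℝ := fun n => 1 / ((n : ℝ) + 1) with hε
  have hεpos : ∀ n, 0 < ε n := fun n => Nat.one_div_pos_of_nat
  have hε0 : Tendsto ε atTop (𝓝[≠] 0) := tendsto_one_div_add_one_nhdsNE
  have hεn : Tendsto (fun n => -ε n) atTop (𝓝[≠] 0) := by
    refine tendsto_nhdsWithin_iff.2 ⟨?_, Eventually.of_forall fun n => (neg_lt_zero.2 (hεpos n)).ne⟩
    simpa using (tendsto_nhdsWithin_iff.1 hε0).1.neg
  have hβc : ContinuousOn β (Icc 0 C) := fun r hr => (hβ r hr).continuousAt.continuousWithinAt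
  obtain ⟨L, hL⟩ := isCompact_Icc.exists_bound_of_continuousOn hβ'
  obtain ⟨M, hM⟩ := isCompact_Icc.exists_bound_of_continuousOn hβc
  have hC : 0 ≤ C := (abs_nonneg _).trans (H.abs_le 0 0)
  have hL0 : 0 ≤ L := (norm_nonneg _).trans (hL 0 ⟨le_rfl, hC⟩)
  have hlimy : ∀ τ, ∀ᵐ y, Tendsto (fun n => boxAvg (ε n) (q τ) y) atTop (𝓝 (q τ y)) := fun τ =>
    ae_tendsto_boxAvg (H.locallyIntegrable τ) hε0
  have hβlim : ∀ τ y, Tendsto (fun n => boxAvg (ε n) (q τ) y) atTop (𝓝 (q τ y)) →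
      Tendsto (fun n => β (boxAvg (ε n) (q τ) y)) atTop (𝓝 (β (q τ y))) := fun τ y hy =>
    (hβ _ (H.mem_Icc τ y)).continuousAt.tendsto.comp hy
  -- Fubini exchanges the quantifiers: the local term of the flux is evaluated at a fixed x and
  -- integrated in τ.
  have hlimx : ∀ᵐ x, ∀ᵐ τ, Tendsto (fun n => boxAvg (ε n) (q τ) x) atTop (𝓝 (q τ x)) := by
    refine (Measure.ae_ae_comm ?_).1 (Eventually.of_forall hlimy)
    exact measurableSet_tendsto_fun (fun n => (H.density.continuous_boxAvg (ε n)).measurable)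
      H.density.measurable
  have hslope : ∀ h τ y, |h⁻¹ * (b τ (y + h) - b τ y)| ≤ K := fun h τ y => by
    have := (H.lipschitz τ).dist_le_mul (y + h) y
    rw [Real.dist_eq, Real.dist_eq, add_sub_cancel_left] at this
    rw [abs_mul, abs_inv]
    calc |h|⁻¹ * |b τ (y + h) - b τ y| ≤ |h|⁻¹ * (K * |h|) := by gcongr
      _ = K * (|h|⁻¹ * |h|) := by ring
      _ ≤ K * 1 := by gcongr; exact inv_mul_le_one
      _ = K := mul_one _
  have hprod : ∀ r₁ ∈ Icc 0 C, ∀ r₂, |r₂| ≤ C → ∀ d : ℝ, |d| ≤ K → |β' r₁ * r₂ * d| ≤ L * C * K := by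
    intro r₁ h1 r₂ h2 d h3
    rw [abs_mul, abs_mul]
    have := hL r₁ h1
    rw [Real.norm_eq_abs] at this
    gcongr
  filter_upwards [hlimx] with x hx t ht
  have hβQ := fun n => (H.regularField_boxAvg (hεpos n)).comp hβm hβc (H.boxAvg_mem (hεpos n))
  have hGn := fun n => ((((H.regularField_boxAvg (hεpos n)).comp hβ'm hβ'
    (H.boxAvg_mem (hεpos n))).mul (H.density.comp_add_right (ε n))).mul
      (((H.velocity.comp_add_right (ε n)).sub H.velocity).const_mul (ε n)⁻¹))
  have hleft : ∀ s, Tendsto (fun n => expTail k (fun y => β (boxAvg (ε n) (q s) y)) x) atTop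
      (𝓝 (expTail k (fun y => β (q s y)) x)) := fun s =>
    tendsto_expTail hk (fun n => (hβQ n).measurable_section s)
      (fun n y => hM _ (H.boxAvg_mem (hεpos n) s y))
      (by filter_upwards [hlimy s] with y hy using hβlim s y hy) x
  have hGlim : ∀ τ, Tendsto (fun n => expTail k (fun y => β' (boxAvg (ε n) (q τ) y) *
      q τ (y + ε n) * ((ε n)⁻¹ * (b τ (y + ε n) - b τ y))) x) atTop
      (𝓝 (expTail k (fun y => β' (q τ y) * q τ y * B τ y) x)) := by
    intro τ
    -- Translating the variable by `ε n` replaces q(y + ε) by q(y) and turns the forward average and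
    -- quotient into backward ones, which converge almost everywhere. The price is that the tail is
    -- evaluated at x + ε, which is harmless because the tails are Lipschitz uniformly in n.
    set S : ℕ → ℝ → ℝ := fun n y => β' (boxAvg (-ε n) (q τ) y) * q τ y *
      ((-ε n)⁻¹ * (b τ (y + -ε n) - b τ y)) with hS
    have hSmem : ∀ n y, boxAvg (-ε n) (q τ) y ∈ Icc 0 C := fun n y => by
      rw [boxAvg_neg]; exact H.boxAvg_mem (hεpos n) τ _
    have hSm : ∀ n, Measurable (S n) := fun n => by
      have h1 : Measurable (boxAvg (-ε n) (q τ)) := (lipschitzWith_boxAvg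
        (H.locallyIntegrable τ) (Eventually.of_forall (H.abs_le τ))).continuous.measurable
      exact ((hβ'm.comp h1).mul (H.density.measurable_section τ)).mul
        ((((H.velocity.comp_add_right (-ε n)).sub H.velocity).const_mul
          (-ε n)⁻¹).measurable_section τ)
    have hSb : ∀ n y, |S n y| ≤ L * C * K := fun n y =>
      hprod _ (hSmem n y) _ (H.abs_le τ y) _ (hslope _ τ y)
    have hSlim := tendsto_expTail hk hSm hSb (g₀ := fun y => β' (q τ y) * q τ y * B τ y) (by
      filter_upwards [H.hasDerivAt τ, ae_tendsto_boxAvg (H.locallyIntegrable τ) hεn] with y h1 h2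
      refine Tendsto.mul (Tendsto.mul_const _ ?_) (h1.tendsto_slope_zero.comp hεn)
      exact (hβ' _ (H.mem_Icc τ y)).tendsto.comp
        (tendsto_nhdsWithin_iff.2 ⟨h2, Eventually.of_forall fun n => hSmem n y⟩)) x
    have hshift : ∀ n, expTail k (fun y => β' (boxAvg (ε n) (q τ) y) *
        q τ (y + ε n) * ((ε n)⁻¹ * (b τ (y + ε n) - b τ y))) x = expTail k (S n) (x + ε n) := by
      intro n
      rw [← expTail_comp_add_right]
      congr 1; ext y
      simp only [hS, boxAvg_neg, add_sub_cancel_right, ← sub_eq_add_neg, inv_neg]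
      ring
    simp only [hshift]
    refine tendsto_of_tendsto_of_dist hSlim ?_
    refine squeeze_zero (fun _ => dist_nonneg) (fun n =>
      (lipschitzWith_expTail hk (hSm n) (hSb n)).dist_le_mul x (x + ε n)) ?_
    have : Tendsto (fun n => dist x (x + ε n)) atTop (𝓝 0) := by
      simpa [Real.dist_eq] using (tendsto_nhdsWithin_iff.1 hε0).1.abs
    simpa using this.const_mul _
  refine tendsto_nhds_unique ((hleft t).sub (hleft 0)) ?_
  refine (tendsto_integral_renormalizedFlux (M := max M (L * C * K)) hk H.velocity H.slope hβQ hGn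
    (fun n τ y => (hM _ (H.boxAvg_mem (hεpos n) τ y)).trans (le_max_left _ _))
    (fun n τ y => (hprod _ (H.boxAvg_mem (hεpos n) τ y) _ (H.abs_le _ _) _
      (hslope _ _ _)).trans (le_max_right _ _)) (hx.mono fun τ hτ => hβlim τ x hτ)
    (fun τ => (hlimy τ).mono fun y hy => hβlim τ y hy) hGlim).congr fun n => ?_
  exact (H.expTail_boxAvg_sub hT hk hβm hβ'm hβ hβ' (hεpos n) x ht).symm

/-- The renormalized continuity equation for the power `q ^ p`, for any `p > 0`. -/
theorem ae_expTail_rpow_sub (H : ContinuityEquation T C K q b B) (hT : 0 ≤ T) (hk : 0 < k)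
    {p : ℝ} (hp : 0 < p) :
    ∀ᵐ x, ∀ t ∈ Icc 0 T, expTail k (fun y => q t y ^ p) x - expTail k (fun y => q 0 y ^ p) x =
      ∫ τ in 0..t, renormalizedFlux k b B (fun τ y => q τ y ^ p)
        (fun τ y => p * q τ y ^ p * B τ y) τ x := by
  -- For p < 1 the derivative of s^p blows up at 0, so the power is approximated by (s+δ)^p. The
  -- source stays bounded because s (s+δ)^{p-1} ≤ (s+δ)^p.
  set δ : ℕ → ℝ := fun n => 1 / ((n : ℝ) + 1) with hδ
  have hδpos : ∀ n, 0 < δ n := fun n => Nat.one_div_pos_of_nat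
  have hδ1 : ∀ n, δ n ≤ 1 := fun n => by
    rw [hδ, div_le_one (by positivity)]; linarith [n.cast_nonneg (α := ℝ)]
  have hδ0 : Tendsto δ atTop (𝓝 0) := tendsto_one_div_add_atTop_nhds_zero_nat
  have hβm : ∀ (r : ℝ) n, Measurable fun s : ℝ => (s + δ n) ^ r := fun r n => by fun_prop
  have hβ : ∀ n, ∀ r ∈ Icc 0 C,
      HasDerivAt (fun s : ℝ => (s + δ n) ^ p) (p * (r + δ n) ^ (p - 1)) r := fun n r hr => by
    have h0 : r + δ n ≠ 0 := (add_pos_of_nonneg_of_pos hr.1 (hδpos n)).ne'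
    simpa using ((hasDerivAt_id r).add_const (δ n)).rpow_const (p := p) (Or.inl h0)
  have hβc : ∀ (r : ℝ) n, ContinuousOn (fun s : ℝ => (s + δ n) ^ r) (Icc 0 C) := fun r n =>
    ContinuousOn.rpow_const (by fun_prop) fun s hs =>
      Or.inl (add_pos_of_nonneg_of_pos hs.1 (hδpos n)).ne'
  have hlim : ∀ τ y, Tendsto (fun n => (q τ y + δ n) ^ p) atTop (𝓝 (q τ y ^ p)) := fun τ y => by
    simpa using (hδ0.const_add (q τ y)).rpow_const (p := p) (Or.inr hp.le)
  have hlim' : ∀ τ y, Tendsto (fun n => p * (q τ y + δ n) ^ (p - 1) * q τ y) atTop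
      (𝓝 (p * q τ y ^ p)) := fun τ y => by
    rcases (H.mem_Icc τ y).1.eq_or_lt with h0 | h0
    · simp [← h0, Real.zero_rpow hp.ne']
    · have := (((hδ0.const_add (q τ y)).rpow_const (p := p - 1)
        (Or.inl (by simpa using h0.ne'))).const_mul p).mul_const (q τ y)
      rwa [add_zero, mul_assoc, ← Real.rpow_add_one h0.ne', sub_add_cancel] at this
  have hbd : ∀ n τ y, |(q τ y + δ n) ^ p| ≤ (C + 1) ^ p := fun n τ y => by
    have h0 := add_pos_of_nonneg_of_pos (H.mem_Icc τ y).1 (hδpos n)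
    rw [abs_of_nonneg (by positivity)]
    exact Real.rpow_le_rpow h0.le (add_le_add (H.mem_Icc τ y).2 (hδ1 n)) hp.le
  have hbd' : ∀ n τ y, |p * (q τ y + δ n) ^ (p - 1) * q τ y| ≤ p * (C + 1) ^ p := fun n τ y => by
    have h0 := add_pos_of_nonneg_of_pos (H.mem_Icc τ y).1 (hδpos n)
    have h1 := (H.mem_Icc τ y).1
    rw [abs_of_nonneg (by positivity), mul_assoc]
    refine mul_le_mul_of_nonneg_left (le_trans ?_ (le_of_abs_le (hbd n τ y))) hp.le
    calc (q τ y + δ n) ^ (p - 1) * q τ y ≤ (q τ y + δ n) ^ (p - 1) * (q τ y + δ n) := by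
          gcongr; linarith [hδpos n]
      _ = (q τ y + δ n) ^ p := by rw [← Real.rpow_add_one h0.ne', sub_add_cancel]
  obtain ⟨N, hN⟩ := H.slope.bounded
  have hbd'' : ∀ n τ y, |p * (q τ y + δ n) ^ (p - 1) * q τ y * B τ y| ≤ p * (C + 1) ^ p * N :=
    fun n τ y => by
      rw [abs_mul]
      exact mul_le_mul (hbd' n τ y) (hN τ y) (abs_nonneg _) ((abs_nonneg _).trans (hbd' n τ y))
  have hf : ∀ n, RegularField fun τ y => (q τ y + δ n) ^ p := fun n =>
    H.density.comp (hβm p n) (hβc p n) H.mem_Icc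
  have hG : ∀ n, RegularField fun τ y => p * (q τ y + δ n) ^ (p - 1) * q τ y * B τ y := fun n =>
    (((H.density.comp (hβm (p - 1) n) (hβc (p - 1) n) H.mem_Icc).const_mul p).mul
      H.density).mul H.slope
  filter_upwards [ae_all_iff.2 fun n => H.ae_expTail_comp_sub hT hk (hβm p n)
    ((hβm (p - 1) n).const_mul p) (hβ n) ((hβc (p - 1) n).const_mul p)] with x hx t ht
  have hleft : ∀ s, Tendsto (fun n => expTail k (fun y => (q s y + δ n) ^ p) x) atTop
      (𝓝 (expTail k (fun y => q s y ^ p) x)) := fun s =>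
    tendsto_expTail hk (fun n => (hf n).measurable_section s) (fun n => hbd n s)
      (Eventually.of_forall (hlim s)) x
  refine tendsto_nhds_unique ((hleft t).sub (hleft 0)) ?_
  refine (tendsto_integral_renormalizedFlux (M := max ((C + 1) ^ p) (p * (C + 1) ^ p * N)) hk
    H.velocity H.slope hf hG (fun n τ y => (hbd n τ y).trans (le_max_left _ _))
    (fun n τ y => (hbd'' n τ y).trans (le_max_right _ _))
    (Eventually.of_forall fun τ => hlim τ x) (fun τ => Eventually.of_forall (hlim τ))
    fun τ => ?_).congr fun n => ((hx n) t ht).symm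
  exact tendsto_expTail hk (fun n => (hG n).measurable_section τ) (fun n => hbd'' n τ)
    (Eventually.of_forall fun y => (hlim' τ y).mul_const _) x

end ContinuityEquation

/-! ### Weak derivatives on the line -/

theorem exists_support_subset_Ioo {φ : ℝ → ℝ} (hφ : HasCompactSupport φ) :
    ∃ R : ℝ, 0 < R ∧ ∀ x, φ x ≠ 0 → x ∈ Ioo (-R) R := by
  obtain ⟨R, hR, hsub⟩ := hφ.isCompact.isBounded.subset_ball_lt 0 0
  refine ⟨R, hR, fun x hx => ?_⟩
  have := hsub (subset_tsupport _ (Function.mem_support.2 hx))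
  rwa [Real.ball_eq_Ioo, zero_sub, zero_add] at this

theorem integral_primitive_mul_deriv {g φ : ℝ → ℝ} (hg : LocallyIntegrable g volume)
    (hφ : ContDiff ℝ 1 φ) (hφc : HasCompactSupport φ) :
    ∫ x, (∫ y in 0..x, g y) * deriv φ x = -∫ x, g x * φ x := by
  obtain ⟨R, hR, hsupp⟩ := exists_support_subset_Ioo hφc
  obtain ⟨R', hR', hsupp'⟩ := exists_support_subset_Ioo (hφc.deriv)
  set r := max R R' with hr
  have hr0 : 0 < r := hR.trans_le (le_max_left _ _)
  have hz : ∀ x, x ∉ Ioo (-r) r → φ x = 0 := fun x hx => by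
    by_contra h
    have := hsupp x h
    exact hx ⟨(neg_le_neg (le_max_left R R')).trans_lt this.1, this.2.trans_le (le_max_left _ _)⟩
  have hz' : ∀ x, x ∉ Ioo (-r) r → deriv φ x = 0 := fun x hx => by
    by_contra h
    have := hsupp' x h
    exact hx ⟨(neg_le_neg (le_max_right R R')).trans_lt this.1, this.2.trans_le (le_max_right _ _)⟩
  have hsub : ∀ F : ℝ → ℝ, (∀ x, x ∉ Ioo (-r) r → F x = 0) → ∫ x in (-r)..r, F x = ∫ x, F x :=
    fun F hF => intervalIntegral.integral_eq_integral_of_support_subset fun x hx =>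
      Ioo_subset_Ioc_self (by by_contra h; exact hx (hF x h))
  have hi : IntervalIntegrable g volume (-r) r :=
    (hg.integrableOn_isCompact isCompact_uIcc).intervalIntegrable
  have hac := hi.absolutelyContinuousOnInterval_intervalIntegral (c := 0)
    (by rw [uIcc_of_le (by linarith)]; exact ⟨by linarith, hr0.le⟩)
  have hφac : AbsolutelyContinuousOnInterval φ (-r) r :=
    hφ.contDiffOn.absolutelyContinuousOnInterval
  have hibp := hac.integral_mul_deriv_eq_deriv_mul hφac
  rw [hz r (by simp), hz (-r) (by simp), mul_zero, mul_zero, sub_zero, zero_sub,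
    hsub _ fun x hx => by rw [hz' x hx, mul_zero]] at hibp
  rw [hibp, ← hsub (fun x => g x * φ x) fun x hx => by rw [hz x hx, mul_zero]]
  congr 1
  refine intervalIntegral.integral_congr_ae ?_
  filter_upwards [LocallyIntegrable.ae_hasDerivAt_integral hg] with x hx _
  rw [(hx 0).deriv]

theorem LocallyIntegrable.integrable_mul_of_continuous {f φ : ℝ → ℝ}
    (hf : LocallyIntegrable f volume) (hφ : Continuous φ) (hφc : HasCompactSupport φ) :
    Integrable (fun x => f x * φ x) := by
  simpa [mul_comm] using! hf.integrable_smul_left_of_hasCompactSupport hφ hφc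

/-- A locally integrable function with vanishing weak derivative is constant. -/
theorem exists_ae_eq_const_of_integral_mul_deriv_eq_zero {h : ℝ → ℝ}
    (hh : LocallyIntegrable h volume)
    (h0 : ∀ φ : ℝ → ℝ, ContDiff ℝ ((⊤ : ℕ∞) : WithTop ℕ∞) φ → HasCompactSupport φ →
      ∫ x, h x * deriv φ x = 0) : ∃ c, ∀ᵐ x, h x = c := by
  let B : ContDiffBump (0 : ℝ) := ⟨1, 2, one_pos, one_lt_two⟩
  set ρ : ℝ → ℝ := B.normed volume with hρ
  have hρs : ContDiff ℝ ((⊤ : ℕ∞) : WithTop ℕ∞) ρ := B.contDiff_normed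
  have hρc : HasCompactSupport ρ := B.hasCompactSupport_normed
  have hρ1 : ∫ x, ρ x = 1 := B.integral_normed
  refine ⟨∫ x, h x * ρ x, ae_eq_of_integral_contDiff_smul_eq hh (locallyIntegrable_const _)
    fun ψ hψ hψc => ?_⟩
  set I := ∫ x, ψ x with hI
  set θ : ℝ → ℝ := fun x => ψ x - I * ρ x with hθ
  -- Subtracting a multiple of the unit-mass bump makes the integral of θ vanish, so its primitive
  -- has compact support and is an admissible test function. The constant is therefore the mean of h
  -- against ρ.
  have hθs : ContDiff ℝ ((⊤ : ℕ∞) : WithTop ℕ∞) θ := hψ.sub (contDiff_const.mul hρs)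
  have hθc : HasCompactSupport θ := hψc.sub hρc.mul_left
  have hψi : Integrable ψ := hψ.continuous.integrable_of_hasCompactSupport hψc
  have hρi : Integrable ρ := hρs.continuous.integrable_of_hasCompactSupport hρc
  have hθ0 : ∫ x, θ x = 0 := by
    rw [hθ, integral_sub hψi (hρi.const_mul _), integral_const_mul, hρ1]; simp [hI]
  obtain ⟨R, hR, hsupp⟩ := exists_support_subset_Ioo hθc
  set Φ : ℝ → ℝ := fun x => ∫ y in (-R)..x, θ y with hΦ
  have hΦd : ∀ x, HasDerivAt Φ (θ x) x := fun x =>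
    (hθs.continuous.integral_hasStrictDerivAt (-R) x).hasDerivAt
  have hΦ' : deriv Φ = θ := funext fun x => (hΦd x).deriv
  have hΦs : ContDiff ℝ ((⊤ : ℕ∞) : WithTop ℕ∞) Φ := by
    rw [contDiff_infty_iff_deriv, hΦ']
    exact ⟨fun x => (hΦd x).differentiableAt, hθs⟩
  have hΦc : HasCompactSupport Φ := by
    refine HasCompactSupport.intro (isCompact_Icc (a := -R) (b := R)) fun x hx => ?_
    have hz : ∀ y, y ∉ Ioo (-R) R → θ y = 0 := fun y hy => by
      by_contra h; exact hy (hsupp y h)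
    rcases le_or_gt x (-R) with h1 | h1
    · refine (intervalIntegral.integral_congr (g := fun _ => 0) fun y hy => ?_).trans (by simp)
      rw [uIcc_of_ge h1] at hy
      exact hz y fun h => absurd h.1 (not_lt.2 hy.2)
    · have h2 : R ≤ x := by
        by_contra h
        exact hx ⟨h1.le, (not_le.1 h).le⟩
      rw [hΦ]
      simp only
      rw [intervalIntegral.integral_eq_integral_of_support_subset, hθ0]
      exact fun y hy => ⟨(hsupp y hy).1, (hsupp y hy).2.le.trans h2⟩
  have := h0 Φ hΦs hΦc
  rw [hΦ'] at this
  have e : ∀ x, h x * θ x = ψ x • h x - I * (h x * ρ x) := fun x => by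
    simp only [hθ, smul_eq_mul]; ring
  simp only [e] at this
  have hψh : Integrable fun x => ψ x • h x := by
    simpa [mul_comm] using LocallyIntegrable.integrable_mul_of_continuous hh hψ.continuous hψc
  rw [integral_sub hψh ((LocallyIntegrable.integrable_mul_of_continuous hh hρs.continuous
      hρc).const_mul I), integral_const_mul] at this
  simp only [smul_eq_mul] at this ⊢
  rw [integral_mul_const, ← hI]
  linarith

/-- The difference between f and the primitive of g has zero weak derivative. -/
theorem IsWeakDerivOnLine.exists_ae_eq {f g : ℝ → ℝ} (h : IsWeakDerivOnLine f g) :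
    ∃ c, ∀ᵐ x, f x = c + ∫ y in 0..x, g y := by
  obtain ⟨hf, hg, hfg⟩ := h
  have hi : ∀ a b, IntervalIntegrable g volume a b := fun a b =>
    (hg.integrableOn_isCompact isCompact_uIcc).intervalIntegrable
  have hG : Continuous fun x => ∫ y in 0..x, g y :=
    intervalIntegral.continuous_primitive hi 0
  have hGl : LocallyIntegrable (fun x => ∫ y in 0..x, g y) volume := hG.locallyIntegrable
  obtain ⟨c, hc⟩ := exists_ae_eq_const_of_integral_mul_deriv_eq_zero (hf.sub hGl)
    fun φ hφ hφc => by
      have h1 : ContDiff ℝ 1 φ := hφ.of_le (by exact_mod_cast le_top)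
      have hd : Continuous (deriv φ) := h1.continuous_deriv le_rfl
      simp only [Pi.sub_apply, sub_mul]
      rw [integral_sub (LocallyIntegrable.integrable_mul_of_continuous hf hd hφc.deriv)
        (LocallyIntegrable.integrable_mul_of_continuous hGl hd hφc.deriv), hfg φ hφ hφc,
        integral_primitive_mul_deriv hg h1 hφc, sub_self]
  refine ⟨c, hc.mono fun x hx => ?_⟩
  simp only [Pi.sub_apply] at hx
  linarith

/-- The first weak derivative agrees almost everywhere with a primitive of the second, which is
continuous; V is then a primitive of a continuous function, everywhere and not just almost
everywhere because V is continuous. -/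
theorem VelocityAssumption.contDiff {V : ℝ → ℝ} (hV : VelocityAssumption V) : ContDiff ℝ 1 V := by
  obtain ⟨f₁, f₂, h1, h2, -⟩ := hV.sobolev
  obtain ⟨c₁, hc₁⟩ := h2.exists_ae_eq
  obtain ⟨c, hc⟩ := h1.exists_ae_eq
  set F : ℝ → ℝ := fun x => c₁ + ∫ y in 0..x, f₂ y with hF
  have hFc : Continuous F := (intervalIntegral.continuous_primitive (fun a b =>
    (h2.2.1.integrableOn_isCompact isCompact_uIcc).intervalIntegrable) 0).const_add c₁
  have hVae : V =ᵐ[volume] fun x => c + ∫ y in 0..x, F y := by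
    filter_upwards [hc] with x hx
    rw [hx]
    congr 1
    exact intervalIntegral.integral_congr_ae (hc₁.mono fun y hy _ => hy)
  have hVeq : V = fun x => c + ∫ y in 0..x, F y :=
    (hV.continuous.ae_eq_iff_eq volume ((intervalIntegral.continuous_primitive
      (fun a b => hFc.intervalIntegrable a b) 0).const_add c)).1 hVae
  have hd : ∀ x, HasDerivAt V (F x) x := fun x => by
    rw [hVeq]
    exact ((hFc.integral_hasStrictDerivAt 0 x).hasDerivAt).const_add c
  rw [contDiff_one_iff_deriv]
  refine ⟨fun x => (hd x).differentiableAt, ?_⟩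
  rwa [funext fun x => (hd x).deriv]

/-! ### From the weak formulation to the integrated balance law -/

/-- The fundamental lemma of the calculus of variations with an initial value. The test functions do
not have to vanish at time 0, so primitives of arbitrary bumps on (0,T) are admissible and m₀ is
identified as well. -/
theorem eq_add_integral_of_weak_in_time {T m₀ : ℝ} {m f : ℝ → ℝ} (hT : 0 < T) (hm : Continuous m)
    (hf : Continuous f)
    (hw : ∀ χ : ℝ → ℝ, ContDiff ℝ 1 χ → HasCompactSupport χ → tsupport χ ⊆ Ioo (-42) T →
      (∫ t in Ioo 0 T, (deriv χ t * m t + χ t * f t)) + χ 0 * m₀ = 0) :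
    ∀ t ∈ Icc 0 T, m t = m₀ + ∫ s in 0..t, f s := by
  set F : ℝ → ℝ := fun t => m₀ + ∫ s in 0..t, f s with hF
  have hFd : ∀ t, HasDerivAt F (f t) t := fun t =>
    ((hf.integral_hasStrictDerivAt 0 t).hasDerivAt).const_add m₀
  have hFc : Continuous F := continuous_iff_continuousAt.2 fun t => (hFd t).continuousAt
  have hIoo : ∀ g : ℝ → ℝ, ∫ t in Ioo 0 T, g t = ∫ t in 0..T, g t := fun g => by
    rw [intervalIntegral.integral_of_le hT.le, integral_Ioc_eq_integral_Ioo]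
  have key : ∀ᵐ t, t ∈ Ioo 0 T → m t - F t = 0 := by
    refine isOpen_Ioo.ae_eq_zero_of_integral_contDiff_smul_eq_zero
      ((hm.sub hFc).locallyIntegrable.locallyIntegrableOn (Ioo 0 T)) fun θ hθ hθc hθs => ?_
    obtain ⟨b, hbT, hb0, hb⟩ : ∃ b < T, 0 < b ∧ ∀ t, b < t → θ t = 0 := by
      rcases (tsupport θ).eq_empty_or_nonempty with h | h
      · refine ⟨T / 2, by linarith, by linarith, fun t _ => ?_⟩
        exact image_eq_zero_of_notMem_tsupport (by simp [h])
      · obtain ⟨b, hbS, hb⟩ := hθc.isCompact.exists_isGreatest h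
        exact ⟨b, (hθs hbS).2, (hθs hbS).1, fun t ht =>
          image_eq_zero_of_notMem_tsupport fun h => absurd (hb h) (not_le.2 ht)⟩
    -- Integrating from T makes Φ vanish near T and beyond; its value at 0 produces the initial
    -- term.
    set Φ : ℝ → ℝ := fun t => ∫ s in T..t, θ s with hΦ
    have hΦd : ∀ t, HasDerivAt Φ (θ t) t := fun t =>
      (hθ.continuous.integral_hasStrictDerivAt T t).hasDerivAt
    have hΦs : ContDiff ℝ 1 Φ := by
      rw [contDiff_one_iff_deriv, funext fun t => (hΦd t).deriv]
      exact ⟨fun t => (hΦd t).differentiableAt, hθ.continuous⟩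
    have hΦ0 : ∀ t, b < t → Φ t = 0 := fun t ht => by
      refine (intervalIntegral.integral_congr (g := fun _ => 0) fun s hs => ?_).trans (by simp)
      refine hb s (lt_of_lt_of_le ?_ hs.1)
      exact lt_inf_iff.2 ⟨hbT, ht⟩
    -- The cutoff is 0 for t ≤ -2 and 1 for t ≥ -1: it makes the support compact inside (-42, T) and
    -- does not affect [0,T].
    set κ : ℝ → ℝ := fun t => Real.smoothTransition (t + 2) with hκ
    have hκs : ContDiff ℝ 1 κ := Real.smoothTransition.contDiff.comp (by fun_prop)
    have hκ1 : ∀ t, -1 ≤ t → κ t = 1 := fun t ht =>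
      Real.smoothTransition.one_of_one_le (by linarith)
    have hzero : ∀ t, t ∉ Icc (-2) b → κ t * Φ t = 0 := fun t ht => by
      rcases lt_or_ge b t with h | h
      · rw [hΦ0 t h, mul_zero]
      · rw [hκ]
        simp only
        rw [Real.smoothTransition.zero_of_nonpos, zero_mul]
        by_contra h2
        exact ht ⟨by linarith, h⟩
    have hts : tsupport (fun t => κ t * Φ t) ⊆ Icc (-2) b :=
      closure_minimal (fun t ht => by by_contra h; exact ht (hzero t h)) isClosed_Icc
    have hw' := hw (fun t => κ t * Φ t) (hκs.mul hΦs)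
      (HasCompactSupport.intro isCompact_Icc hzero)
      (hts.trans fun t ht => ⟨by linarith [ht.1], ht.2.trans_lt hbT⟩)
    have hχd : ∀ t ∈ Icc 0 T, HasDerivAt (fun t => κ t * Φ t) (θ t) t := fun t ht => by
      refine (hΦd t).congr_of_eventuallyEq ?_
      filter_upwards [lt_mem_nhds (show (-1 : ℝ) < t by linarith [ht.1])] with s hs
      rw [hκ1 s hs.le, one_mul]
    have hΦc : Continuous Φ := hΦs.continuous
    have e1 : ∫ t in Ioo 0 T, (deriv (fun t => κ t * Φ t) t * m t + κ t * Φ t * f t) =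
        ∫ t in 0..T, (θ t * m t + Φ t * f t) := by
      rw [hIoo]
      refine intervalIntegral.integral_congr fun t ht => ?_
      rw [uIcc_of_le hT.le] at ht
      rw [(hχd t ht).deriv, hκ1 t (by linarith [ht.1]), one_mul]
    have e2 : ∫ t in 0..T, (θ t * F t + Φ t * f t) = Φ T * F T - Φ 0 * F 0 :=
      intervalIntegral.integral_eq_sub_of_hasDerivAt (f := fun t => Φ t * F t)
        (fun t _ => (hΦd t).mul (hFd t)) (by
          have := hθ.continuous
          exact Continuous.intervalIntegrable (by fun_prop) _ _)
    have hF0 : F 0 = m₀ := by simp [hF]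
    rw [hΦ0 T hbT, zero_mul, zero_sub, hF0] at e2
    rw [e1, hκ1 0 (by norm_num), one_mul] at hw'
    have e3 : (∫ t in 0..T, (θ t * m t + Φ t * f t)) - ∫ t in 0..T, (θ t * F t + Φ t * f t) =
        ∫ t, θ t • (m t - F t) := by
      have := hθ.continuous
      rw [← intervalIntegral.integral_sub (Continuous.intervalIntegrable (by fun_prop) _ _)
        (Continuous.intervalIntegrable (by fun_prop) _ _),
        ← intervalIntegral.integral_eq_integral_of_support_subset (a := 0) (b := T)]
      · refine intervalIntegral.integral_congr fun t _ => ?_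
        ring_nf
      · intro t ht
        have : θ t ≠ 0 := fun h => ht (by simp [h])
        exact Ioo_subset_Ioc_self (hθs (subset_tsupport _ this))
    rw [← e3, e2]
    linarith
  have h1 : EqOn m F (Ioo 0 T) := by
    refine Measure.eqOn_open_of_ae_eq (μ := volume) ?_ isOpen_Ioo hm.continuousOn hFc.continuousOn
    rw [EventuallyEq, ae_restrict_iff' measurableSet_Ioo]
    exact key.mono fun t ht hmem => sub_eq_zero.1 (ht hmem)
  have h2 := h1.closure hm hFc
  rwa [closure_Ioo hT.ne] at h2

theorem volume_restrict_spaceTime (T : ℝ) :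
    (volume : Measure (ℝ × ℝ)).restrict (spaceTime T) =
      (volume.restrict (Ioo 0 T)).prod (volume : Measure ℝ) := by
  rw [spaceTime, Measure.volume_eq_prod, ← Measure.prod_restrict, Measure.restrict_univ]

/-- Equality on almost every slice gives equality almost everywhere in space-time only for
measurable sets, so q is first replaced by a strongly measurable version. -/
theorem RegularField.ae_eq_on_spaceTime {T : ℝ} {q r : ℝ → ℝ → ℝ} (hr : RegularField r)
    (hq : AEStronglyMeasurable (fun z : ℝ × ℝ => q z.1 z.2) (volume.restrict (spaceTime T)))
    (h : ∀ t ∈ Icc 0 T, q t =ᵐ[volume] r t) :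
    ∀ᵐ z ∂(volume.restrict (spaceTime T)), q z.1 z.2 = r z.1 z.2 := by
  obtain ⟨g, hg, hqg⟩ := hq
  have hgr : ∀ᵐ z ∂(volume.restrict (spaceTime T)), g z = r z.1 z.2 := by
    rw [volume_restrict_spaceTime] at hqg ⊢
    rw [Measure.ae_prod_iff_ae_ae (p := fun z => g z = r z.1 z.2)
      (measurableSet_eq_fun hg.measurable hr.measurable)]
    filter_upwards [Measure.ae_ae_of_ae_prod hqg, ae_restrict_mem measurableSet_Ioo] with t h1 h2
    filter_upwards [h1, h t (Ioo_subset_Icc_self h2)] with x h3 h4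
    rw [← h3, h4]
  filter_upwards [hqg, hgr] with z h1 h2
  rw [h1, h2]

section balance

variable {T : ℝ} {q₀ : ℝ → ℝ} {q v r b : ℝ → ℝ → ℝ}

/-- Testing with products χ(t)ψ(x) reduces the weak formulation to a one-dimensional statement in
time for the moment of r against ψ. -/
theorem integral_mul_eq_of_weak_form (hT : 0 < T) (hr : RegularField r) (hb : RegularField b)
    (hq : AEStronglyMeasurable (fun z : ℝ × ℝ => q z.1 z.2) (volume.restrict (spaceTime T)))
    (hqr : ∀ t ∈ Icc 0 T, q t =ᵐ[volume] r t) (hvb : ∀ t ∈ Icc 0 T, ∀ x, v t x = b t x)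
    (hw : ∀ φ : ℝ × ℝ → ℝ, ContDiff ℝ 1 φ → HasCompactSupport φ →
      tsupport φ ⊆ Ioo (-42) T ×ˢ (univ : Set ℝ) →
        (∫ z in spaceTime T, (deriv (fun s => φ (s, z.2)) z.1
            + v z.1 z.2 * deriv (fun y => φ (z.1, y)) z.2) * q z.1 z.2)
          + ∫ x, q₀ x * φ (0, x) = 0)
    {ψ : ℝ → ℝ} (hψ : ContDiff ℝ 1 ψ) (hψc : HasCompactSupport ψ) {t : ℝ} (ht : t ∈ Icc 0 T) :
    ∫ x, ψ x * r t x = (∫ x, ψ x * q₀ x) +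
      ∫ τ in 0..t, ∫ x, deriv ψ x * (b τ x * r τ x) := by
  have hψ' : Continuous (deriv ψ) := hψ.continuous_deriv le_rfl
  have hψi : IntegrableOn ψ univ :=
    (hψ.continuous.integrable_of_hasCompactSupport hψc).integrableOn
  have hψi' : IntegrableOn (deriv ψ) univ :=
    (hψ'.integrable_of_hasCompactSupport hψc.deriv).integrableOn
  have hm := hr.continuous_setIntegral_mul hψi
  have hf := (hb.mul hr).continuous_setIntegral_mul hψi'
  simp only [setIntegral_univ] at hm hf
  refine eq_add_integral_of_weak_in_time hT hm hf (fun χ hχ hχc hχs => ?_) t ht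
  have hsub : Function.support (fun z : ℝ × ℝ => χ z.1 * ψ z.2) ⊆ tsupport χ ×ˢ tsupport ψ :=
    fun z hz => ⟨subset_tsupport _ fun h => hz (by simp [h]),
      subset_tsupport _ fun h => hz (by simp [h])⟩
  have hts : tsupport (fun z : ℝ × ℝ => χ z.1 * ψ z.2) ⊆ tsupport χ ×ˢ tsupport ψ :=
    closure_minimal hsub ((isClosed_tsupport _).prod (isClosed_tsupport _))
  have hφc : HasCompactSupport (fun z : ℝ × ℝ => χ z.1 * ψ z.2) :=
    (hχc.isCompact.prod hψc.isCompact).of_isClosed_subset (isClosed_tsupport _) hts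
  have hwφ := hw (fun z => χ z.1 * ψ z.2) ((hχ.comp contDiff_fst).mul (hψ.comp contDiff_snd)) hφc
    (hts.trans (prod_mono hχs (subset_univ _)))
  have hχd : ∀ s x, deriv (fun s => χ s * ψ x) s = deriv χ s * ψ x := fun s x =>
    deriv_mul_const_field (ψ x)
  have hψd : ∀ s x, deriv (fun y => χ s * ψ y) x = χ s * deriv ψ x := fun s x =>
    deriv_const_mul_field (χ s)
  simp only [hχd, hψd] at hwφ
  obtain ⟨M, hM⟩ := hr.bounded
  obtain ⟨N, hN⟩ := (hb.mul hr).bounded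
  have hχ' : Continuous (deriv χ) := hχ.continuous_deriv le_rfl
  have hχint : ∀ g : ℝ → ℝ, Continuous g → Integrable g (volume.restrict (Ioo 0 T)) := fun g hg =>
    (hg.integrableOn_Icc).mono_set Ioo_subset_Icc_self
  have hint : ∀ (g φ : ℝ → ℝ) (G : ℝ → ℝ → ℝ), Continuous g → IntegrableOn φ univ →
      RegularField G → Integrable (fun z : ℝ × ℝ => g z.1 * φ z.2 * G z.1 z.2)
        ((volume.restrict (Ioo 0 T)).prod volume) := by
    intro g φ G hg hφ hG
    obtain ⟨M, hM⟩ := hG.bounded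
    have h1 := (Integrable.mul_prod (hχint g hg) (integrableOn_univ.1 hφ)).mul_const M
    refine h1.mono ?_ (Eventually.of_forall fun z => ?_)
    · exact (Integrable.mul_prod (hχint g hg) (integrableOn_univ.1 hφ)).aestronglyMeasurable.mul
        hG.measurable.aestronglyMeasurable
    rw [norm_mul, norm_mul _ M]
    exact mul_le_mul_of_nonneg_left ((hM _ _).trans (le_abs_self M)) (norm_nonneg _)
  have i1 := hint (deriv χ) ψ r hχ' hψi hr
  have i2 := hint χ (deriv ψ) _ hχ.continuous hψi' (hb.mul hr)
  have e1 : ∫ z in spaceTime T, (deriv χ z.1 * ψ z.2 + v z.1 z.2 * (χ z.1 * deriv ψ z.2)) *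
      q z.1 z.2 = ∫ s in Ioo 0 T, (deriv χ s * (∫ x, ψ x * r s x) +
        χ s * ∫ x, deriv ψ x * (b s x * r s x)) := by
    have h1 : ∫ z in spaceTime T, (deriv χ z.1 * ψ z.2 + v z.1 z.2 * (χ z.1 * deriv ψ z.2)) *
        q z.1 z.2 = ∫ z in spaceTime T, (deriv χ z.1 * ψ z.2 * r z.1 z.2 +
          χ z.1 * deriv ψ z.2 * (b z.1 z.2 * r z.1 z.2)) := by
      refine integral_congr_ae ?_
      filter_upwards [hr.ae_eq_on_spaceTime hq hqr,
        ae_restrict_mem (measurableSet_Ioo.prod MeasurableSet.univ)] with z h1 h2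
      rw [h1, hvb _ (Ioo_subset_Icc_self h2.1)]
      ring
    rw [h1, volume_restrict_spaceTime]
    refine (integral_prod _ (i1.add i2)).trans ?_
    refine integral_congr_ae ?_
    filter_upwards [i1.prod_right_ae, i2.prod_right_ae] with s h1 h2
    refine (integral_add h1 h2).trans ?_
    simp only [mul_assoc, integral_const_mul]
  rw [e1] at hwφ
  refine Eq.trans ?_ hwφ
  rw [← integral_const_mul]
  congr 2
  ext x; ring

theorem ae_eq_initial_of_weak_form (hT : 0 < T) (hr : RegularField r)
    (hq₀ : LocallyIntegrable q₀ volume)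
    (h : ∀ ψ : ℝ → ℝ, ContDiff ℝ 1 ψ → HasCompactSupport ψ → ∀ t ∈ Icc 0 T,
      ∫ x, ψ x * r t x = (∫ x, ψ x * q₀ x) + ∫ τ in 0..t, ∫ x, deriv ψ x * (b τ x * r τ x)) :
    r 0 =ᵐ[volume] q₀ := by
  obtain ⟨M, hM⟩ := hr.bounded
  refine ae_eq_of_integral_contDiff_smul_eq
    (locallyIntegrable_of_bound (hr.measurable_section 0) (hM 0)) hq₀ fun ψ hψ hψc => ?_
  simpa using h ψ (hψ.of_le (by exact_mod_cast le_top)) hψc 0 ⟨le_rfl, hT.le⟩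

/-- At fixed t, the weak form says that the time-integrated flux, as a function of x, has weak
derivative r(0,·) - r(t,·). It is therefore almost everywhere a primitive of it, and its increment
from x to x + ε is the mass lost. -/
theorem ae_balance_of_weak_form (hr : RegularField r) (hb : RegularField b)
    (h₀ : r 0 =ᵐ[volume] q₀)
    (h : ∀ ψ : ℝ → ℝ, ContDiff ℝ 1 ψ → HasCompactSupport ψ → ∀ t ∈ Icc 0 T,
      ∫ x, ψ x * r t x = (∫ x, ψ x * q₀ x) + ∫ τ in 0..t, ∫ x, deriv ψ x * (b τ x * r τ x))
    (ε : ℝ) {t : ℝ} (ht : t ∈ Icc 0 T) :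
    ∀ᵐ x, (∫ y in x..x + ε, r t y) - ∫ y in x..x + ε, r 0 y =
      -∫ τ in 0..t, (b τ (x + ε) * r τ (x + ε) - b τ x * r τ x) := by
  obtain ⟨M, hM⟩ := hr.bounded
  have hbr := hb.mul hr
  obtain ⟨N, hN⟩ := hbr.bounded
  have hloc : ∀ s, LocallyIntegrable (r s) volume := fun s =>
    locallyIntegrable_of_bound (hr.measurable_section s) (hM s)
  have hPm : Measurable fun x => ∫ τ in 0..t, b τ x * r τ x := by
    simp only [intervalIntegral.integral_of_le ht.1]
    exact (StronglyMeasurable.integral_prod_right'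
      (hbr.measurable.comp measurable_swap).stronglyMeasurable).measurable
  have hPb : ∀ x, |∫ τ in 0..t, b τ x * r τ x| ≤ N * |t - 0| := fun x =>
    abs_intervalIntegral_le_of_bound (fun τ => hN τ x) 0 t
  have hweak : IsWeakDerivOnLine (fun x => ∫ τ in 0..t, b τ x * r τ x)
      (fun x => r 0 x - r t x) := by
    refine ⟨locallyIntegrable_of_bound hPm hPb, (hloc 0).sub (hloc t), fun ψ hψ hψc => ?_⟩
    have h1 : ContDiff ℝ 1 ψ := hψ.of_le (by exact_mod_cast le_top)
    have hψ' : Continuous (deriv ψ) := h1.continuous_deriv le_rfl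
    have := hbr.setIntegral_mul_intervalIntegral (ψ := deriv ψ) (S := univ)
      (hψ'.integrable_of_hasCompactSupport hψc.deriv).integrableOn ht.1
    simp only [setIntegral_univ] at this
    simp only [mul_comm _ (deriv ψ _)]
    rw [this]
    have h2 := h ψ h1 hψc t ht
    have h3 : ∫ x, ψ x * q₀ x = ∫ x, ψ x * r 0 x :=
      integral_congr_ae (h₀.mono fun x hx => by simp only [hx])
    have hi : ∀ s, Integrable fun x => ψ x * r s x := fun s => by
      simpa [mul_comm] using LocallyIntegrable.integrable_mul_of_continuous (hloc s)
        h1.continuous hψc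
    have h4 : ∫ x, (r 0 x - r t x) * ψ x = (∫ x, ψ x * r 0 x) - ∫ x, ψ x * r t x := by
      rw [← integral_sub (hi 0) (hi t)]
      congr 1; ext x; ring
    rw [h4]
    linarith
  obtain ⟨c, hc⟩ := hweak.exists_ae_eq
  filter_upwards [hc, (measurePreserving_add_right volume ε).quasiMeasurePreserving.ae hc]
    with x h1 h2
  have hii : ∀ s a b, IntervalIntegrable (r s) volume a b := fun s a b =>
    ((hloc s).integrableOn_isCompact isCompact_uIcc).intervalIntegrable
  rw [intervalIntegral.integral_sub (intervalIntegrable_of_bound (hbr.measurable_time (x + ε))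
    (fun τ => hN τ (x + ε)) 0 t) (intervalIntegrable_of_bound (hbr.measurable_time x)
    (fun τ => hN τ x) 0 t), h1, h2,
    intervalIntegral.integral_sub (hii _ _ _) (hii _ _ _),
    intervalIntegral.integral_sub (hii _ _ _) (hii _ _ _),
    ← intervalIntegral.integral_interval_sub_left (hii t 0 (x + ε)) (hii t 0 x),
    ← intervalIntegral.integral_interval_sub_left (hii 0 0 (x + ε)) (hii 0 0 x)]
  ring

end balance

/-! ### A lower bound for the nonlocal average -/

/-- Above the threshold a one writes s = s^{1-p} s^p, and s^{1-p} is at most its value at one end of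
[a, C], depending on the sign of 1 - p. This turns a lower bound on mass into one on the integral of
the p-th power, for p on either side of 1. -/
theorem le_add_mul_rpow {s a C p : ℝ} (ha : 0 < a) (hs : s ∈ Icc 0 C) :
    s ≤ a + max (a ^ (1 - p)) (C ^ (1 - p)) * s ^ p := by
  rcases le_or_gt s a with h | h
  · have := Real.rpow_nonneg hs.1 p
    have := Real.rpow_nonneg ha.le (1 - p)
    have : 0 ≤ max (a ^ (1 - p)) (C ^ (1 - p)) * s ^ p :=
      mul_nonneg (le_max_of_le_left this) (by assumption)
    linarith
  · have hs0 : 0 < s := ha.trans h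
    have h1 : s ^ (1 - p) ≤ max (a ^ (1 - p)) (C ^ (1 - p)) := by
      rcases le_total 0 (1 - p) with h2 | h2
      · exact le_max_of_le_right (Real.rpow_le_rpow hs.1 hs.2 h2)
      · exact le_max_of_le_left (Real.rpow_le_rpow_of_nonpos ha h.le h2)
    calc s = s ^ (1 - p) * s ^ p := by rw [← Real.rpow_add hs0]; simp
      _ ≤ max (a ^ (1 - p)) (C ^ (1 - p)) * s ^ p := by gcongr
      _ ≤ _ := by linarith

theorem exists_lower_bound_expTail_rpow {T C M k p qmin : ℝ} {r b : ℝ → ℝ → ℝ} (hk : 0 < k)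
    (hp : 0 < p) (hT : 0 ≤ T) (hr : RegularField r) (hrC : ∀ t x, r t x ∈ Icc 0 C)
    (hM : ∀ t x, |b t x * r t x| ≤ M) (hqmin : 0 < qmin) (h0 : ∀ᵐ x, qmin ≤ r 0 x)
    (hbal : ∀ h > 0, ∀ t ∈ Icc 0 T, ∀ᵐ x, (∫ y in x..x + h, r t y) - ∫ y in x..x + h, r 0 y =
      -∫ τ in 0..t, (b τ (x + h) * r τ (x + h) - b τ x * r τ x)) :
    ∃ c > 0, ∀ t ∈ Icc 0 T, ∀ x, c ≤ expTail k (fun y => r t y ^ p) x := by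
  have hM0 : 0 ≤ M := (abs_nonneg _).trans (hM 0 0)
  -- The initial mass on an interval of length L is at least 2TM + 1 and at most 2TM can leave
  -- through the endpoints, so mass at least 1 remains.
  set L := (2 * T * M + 1) / qmin with hL
  have hL0 : 0 < L := by positivity
  -- With this threshold the part below a carries at most L a = 1/2 of the mass.
  set a := 1 / (2 * L) with ha
  have ha0 : 0 < a := by positivity
  set K := max (a ^ (1 - p)) (C ^ (1 - p)) with hK
  have hK0 : 0 < K := lt_max_of_lt_left (by positivity)
  have hrabs : ∀ t x, |r t x| ≤ C := fun t x => by
    rw [abs_of_nonneg (hrC t x).1]; exact (hrC t x).2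
  have hii : ∀ t a b, IntervalIntegrable (r t) volume a b := fun t a b =>
    intervalIntegrable_of_bound (hr.measurable_section t) (hrabs t) a b
  refine ⟨Real.exp (-(k * L)) / (2 * K), by positivity, fun t ht x => ?_⟩
  have hxL : x ≤ x + L := by linarith
  have hmass : 1 ≤ ∫ y in x..x + L, r t y := by
    have hae : ∀ᵐ x, 1 ≤ ∫ y in x..x + L, r t y := by
      filter_upwards [hbal L hL0 t ht] with x hx
      have h1 : |∫ τ in 0..t, (b τ (x + L) * r τ (x + L) - b τ x * r τ x)| ≤ 2 * M * |t - 0| :=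
        abs_intervalIntegral_le_of_bound (fun τ => (abs_sub _ _).trans
          (by linarith [hM τ (x + L), hM τ x])) 0 t
      rw [sub_zero, abs_of_nonneg ht.1] at h1
      have h2 : L * qmin ≤ ∫ y in x..x + L, r 0 y := by
        have := intervalIntegral.integral_mono_ae (a := x) (b := x + L) (by linarith)
          (intervalIntegrable_const (c := qmin)) (hii 0 _ _) h0
        simpa using this
      have h3 : L * qmin = 2 * T * M + 1 := by rw [hL]; field_simp
      have h4 : M * t ≤ M * T := mul_le_mul_of_nonneg_left ht.2 hM0
      linarith [le_abs_self (∫ τ in 0..t, (b τ (x + L) * r τ (x + L) - b τ x * r τ x))]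
    have hcont : Continuous fun x => ∫ y in x..x + L, r t y := by
      have h1 := (lipschitzWith_intervalIntegral_of_bound (hr.measurable_section t)
        (hrabs t) 0).continuous
      have h2 : (fun x => ∫ y in x..x + L, r t y) =
          fun x => (∫ y in 0..x + L, r t y) - ∫ y in 0..x, r t y := funext fun x => by
        rw [intervalIntegral.integral_interval_sub_left (hii _ _ _) (hii _ _ _)]
      rw [h2]
      exact (h1.comp (continuous_add_const L)).sub h1
    have hcl : IsClosed {x | 1 ≤ ∫ y in x..x + L, r t y} := isClosed_le continuous_const hcont
    have := (Measure.dense_of_ae hae).closure_eq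
    rw [hcl.closure_eq] at this
    exact this.symm.subset (mem_univ x)
  have hrp : RegularField fun t y => r t y ^ p :=
    hr.comp (h := fun s => s ^ p) (by fun_prop)
      (continuousOn_id.rpow_const fun _ _ => Or.inr hp.le) hrC
  obtain ⟨N, hN⟩ := hrp.bounded
  have hiip : IntervalIntegrable (fun y => r t y ^ p) volume x (x + L) :=
    intervalIntegrable_of_bound (hrp.measurable_section t) (hN t) _ _
  have hpow : 1 / (2 * K) ≤ ∫ y in x..x + L, r t y ^ p := by
    have h1 := intervalIntegral.integral_mono_on hxL (hii t x (x + L))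
      ((intervalIntegrable_const (c := a)).add (hiip.const_mul K))
      fun y _ => le_add_mul_rpow ha0 (hrC t y)
    rw [intervalIntegral.integral_add intervalIntegrable_const (hiip.const_mul K),
      intervalIntegral.integral_const, intervalIntegral.integral_const_mul, smul_eq_mul,
      add_sub_cancel_left, show L * a = 1 / 2 by rw [ha]; field_simp] at h1
    rw [div_le_iff₀ (by positivity)]
    linarith
  have hcm : Continuous fun y => Real.exp (k * (x - y)) := by fun_prop
  rw [expTail_eq_add hk (hrp.measurable_section t) (hN t) x (x + L)]
  have htail : 0 ≤ expTail k (fun y => r t y ^ p) (x + L) :=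
    integral_nonneg fun y => mul_nonneg (Real.exp_pos _).le (Real.rpow_nonneg (hrC t y).1 p)
  have hmono : Real.exp (-(k * L)) * ∫ y in x..x + L, r t y ^ p ≤
      ∫ y in x..x + L, Real.exp (k * (x - y)) * r t y ^ p := by
    rw [← intervalIntegral.integral_const_mul]
    refine intervalIntegral.integral_mono_on hxL (hiip.const_mul _)
      (hiip.continuousOn_mul hcm.continuousOn) fun y hy => ?_
    have := Real.rpow_nonneg (hrC t y).1 p
    gcongr
    nlinarith [hy.2]
  have := mul_le_mul_of_nonneg_left hpow (Real.exp_pos (-(k * L))).le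
  have h5 := mul_nonneg (Real.exp_pos (k * (x - (x + L)))).le htail
  calc Real.exp (-(k * L)) / (2 * K) = Real.exp (-(k * L)) * (1 / (2 * K)) := by ring
    _ ≤ _ := by linarith

/-! ### The nonlocal average of a density and its derivatives -/

/-- The normalized exponential average of the `p`-th power of the density. -/
noncomputable def powAvg (k p : ℝ) (r : ℝ → ℝ → ℝ) (t x : ℝ) : ℝ :=
  k * expTail k (fun y => r t y ^ p) x

/-- The spatial derivative of `powAvg`. -/
noncomputable def powAvgSlope (k p : ℝ) (r : ℝ → ℝ → ℝ) (t x : ℝ) : ℝ :=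
  k * (powAvg k p r t x - r t x ^ p)

/-- The exponential average of the density in the `p`-norm. -/
noncomputable def normAvg (k p : ℝ) (r : ℝ → ℝ → ℝ) (t x : ℝ) : ℝ := powAvg k p r t x ^ (1 / p)

/-- The spatial derivative of `normAvg`. -/
noncomputable def normAvgSlope (k p : ℝ) (r : ℝ → ℝ → ℝ) (t x : ℝ) : ℝ :=
  1 / p * powAvg k p r t x ^ (1 / p - 1) * powAvgSlope k p r t x

/-- The spatial derivative of the velocity `V (normAvg k p r t x)`. -/
noncomputable def velocitySlope (k p : ℝ) (V : ℝ → ℝ) (r : ℝ → ℝ → ℝ) (t x : ℝ) : ℝ :=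
  deriv V (normAvg k p r t x) * normAvgSlope k p r t x

/-- The time derivative of `powAvg`. -/
noncomputable def powAvgRate (k p : ℝ) (V : ℝ → ℝ) (r : ℝ → ℝ → ℝ) (t x : ℝ) : ℝ :=
  -(V (normAvg k p r t x) * powAvgSlope k p r t x) -
    p * k * expTail k (fun y => velocitySlope k p V r t y * powAvg k p r t y) x +
    (p - 1) * expTail k (fun y => velocitySlope k p V r t y * powAvgSlope k p r t y) x

/-- A bounded density whose exponential average is bounded below. -/
structure NonlocalDensity (C c k p : ℝ) (V : ℝ → ℝ) (r : ℝ → ℝ → ℝ) : Prop where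
  k_pos : 0 < k
  p_pos : 0 < p
  c_pos : 0 < c
  contDiff : ContDiff ℝ 1 V
  regular : RegularField r
  mem_Icc : ∀ t x, r t x ∈ Icc 0 C
  lower : ∀ t x, c ≤ powAvg k p r t x

/-- L is chosen before g, which makes the Lipschitz constants of W and V(W) uniform in time. -/
theorem exists_lipschitzWith_comp {h : ℝ → ℝ} {a b : ℝ} (hh : ContDiffOn ℝ 1 h (Icc a b)) :
    ∃ L : NNReal, ∀ (K : NNReal) (g : ℝ → ℝ), LipschitzWith K g → (∀ x, g x ∈ Icc a b) →
      LipschitzWith (L * K) fun x => h (g x) := by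
  obtain ⟨L, hL⟩ := hh.exists_lipschitzOnWith (by decide) (convex_Icc _ _) isCompact_Icc
  exact ⟨L, fun K g hg hmem => lipschitzOnWith_univ.1
    (hL.comp (lipschitzOnWith_univ.2 hg) fun x _ => hmem x)⟩

section powAvg

variable {C k p : ℝ} {r : ℝ → ℝ → ℝ}

theorem RegularField.rpow (hr : RegularField r) (hp : 0 < p) (hrC : ∀ t x, r t x ∈ Icc 0 C) :
    RegularField fun t y => r t y ^ p :=
  hr.comp (h := fun s => s ^ p) (by fun_prop)
    (continuousOn_id.rpow_const fun _ _ => Or.inr hp.le) hrC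

theorem abs_rpow_le_of_mem_Icc {s : ℝ} (hp : 0 < p) (hs : s ∈ Icc 0 C) : |s ^ p| ≤ C ^ p := by
  rw [abs_of_nonneg (Real.rpow_nonneg hs.1 p)]
  exact Real.rpow_le_rpow hs.1 hs.2 hp.le

theorem powAvg_le (hk : 0 < k) (hp : 0 < p) (hrC : ∀ t x, r t x ∈ Icc 0 C) (t x : ℝ) :
    powAvg k p r t x ≤ C ^ p := by
  have := le_of_abs_le (abs_expTail_le hk (fun y => abs_rpow_le_of_mem_Icc hp (hrC t y)) x)
  calc powAvg k p r t x ≤ k * (C ^ p / k) := mul_le_mul_of_nonneg_left this hk.le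
    _ = C ^ p := by field_simp

theorem continuous_powAvg (hk : 0 < k) (hp : 0 < p) (hr : RegularField r)
    (hrC : ∀ t x, r t x ∈ Icc 0 C) : Continuous (Function.uncurry (powAvg k p r)) :=
  ((hr.rpow hp hrC).continuous_expTail hk).const_mul k

theorem powAvg_nonneg (hk : 0 < k) (hrC : ∀ t x, r t x ∈ Icc 0 C) (t x : ℝ) :
    0 ≤ powAvg k p r t x :=
  mul_nonneg hk.le (integral_nonneg fun y => mul_nonneg (Real.exp_pos _).le
    (Real.rpow_nonneg (hrC t y).1 p))

theorem regularField_powAvg (hk : 0 < k) (hp : 0 < p) (hr : RegularField r)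
    (hrC : ∀ t x, r t x ∈ Icc 0 C) : RegularField (powAvg k p r) :=
  ((hr.rpow hp hrC).expTail_field hk).const_mul k

theorem regularField_normAvg (hk : 0 < k) (hp : 0 < p) (hr : RegularField r)
    (hrC : ∀ t x, r t x ∈ Icc 0 C) : RegularField (normAvg k p r) :=
  (regularField_powAvg hk hp hr hrC).comp (h := fun s => s ^ (1 / p)) (by fun_prop)
    (continuousOn_id.rpow_const fun _ _ => Or.inr (by positivity))
    fun t x => ⟨powAvg_nonneg hk hrC t x, powAvg_le hk hp hrC t x⟩

theorem normAvg_mem_Icc (hk : 0 < k) (hp : 0 < p) (hC : 0 ≤ C) (hrC : ∀ t x, r t x ∈ Icc 0 C)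
    (t x : ℝ) : normAvg k p r t x ∈ Icc 0 C := by
  refine ⟨Real.rpow_nonneg (powAvg_nonneg hk hrC t x) _, ?_⟩
  have := Real.rpow_le_rpow (powAvg_nonneg hk hrC t x) (powAvg_le hk hp hrC t x)
    (show 0 ≤ 1 / p by positivity)
  rwa [← Real.rpow_mul hC, mul_one_div_cancel hp.ne', Real.rpow_one] at this

theorem regularField_velocity (hk : 0 < k) (hp : 0 < p) (hC : 0 ≤ C) (hr : RegularField r)
    (hrC : ∀ t x, r t x ∈ Icc 0 C) {V : ℝ → ℝ} (hV : Continuous V) :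
    RegularField fun t x => V (normAvg k p r t x) :=
  (regularField_normAvg hk hp hr hrC).comp hV.measurable hV.continuousOn
    (normAvg_mem_Icc hk hp hC hrC)

end powAvg

/-! ### Regularity of the average and its closed evolution law -/

namespace NonlocalDensity

variable {C c k p : ℝ} {V : ℝ → ℝ} {r : ℝ → ℝ → ℝ}

theorem C_nonneg (D : NonlocalDensity C c k p V r) : 0 ≤ C :=
  (D.mem_Icc 0 0).1.trans (D.mem_Icc 0 0).2

theorem powAvg_pos (D : NonlocalDensity C c k p V r) (t x : ℝ) : 0 < powAvg k p r t x :=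
  D.c_pos.trans_le (D.lower t x)

theorem powAvg_mem (D : NonlocalDensity C c k p V r) (t x : ℝ) :
    powAvg k p r t x ∈ Icc c (C ^ p) :=
  ⟨D.lower t x, powAvg_le D.k_pos D.p_pos D.mem_Icc t x⟩

theorem normAvg_pos (D : NonlocalDensity C c k p V r) (t x : ℝ) : 0 < normAvg k p r t x :=
  Real.rpow_pos_of_pos (D.powAvg_pos t x) _

theorem normAvg_rpow (D : NonlocalDensity C c k p V r) (t x s : ℝ) :
    normAvg k p r t x ^ s = powAvg k p r t x ^ (1 / p * s) := by
  rw [normAvg, ← Real.rpow_mul (D.powAvg_pos t x).le]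

theorem normAvg_rpow_self (D : NonlocalDensity C c k p V r) (t x : ℝ) :
    normAvg k p r t x ^ p = powAvg k p r t x := by
  rw [D.normAvg_rpow, one_div_mul_cancel D.p_pos.ne', Real.rpow_one]

theorem powAvg_rpow (D : NonlocalDensity C c k p V r) (t x : ℝ) :
    powAvg k p r t x ^ (1 / p - 1) = normAvg k p r t x ^ (1 - p) := by
  rw [D.normAvg_rpow]
  congr 1
  have := D.p_pos.ne'
  field_simp

theorem normAvg_rpow_mul (D : NonlocalDensity C c k p V r) (t x : ℝ) :
    normAvg k p r t x ^ (p - 1) * normAvg k p r t x ^ (1 - p) = 1 := by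
  rw [← Real.rpow_add (D.normAvg_pos t x)]; simp

theorem regularField_powAvg (D : NonlocalDensity C c k p V r) : RegularField (powAvg k p r) :=
  _root_.regularField_powAvg D.k_pos D.p_pos D.regular D.mem_Icc

theorem regularField_powAvgSlope (D : NonlocalDensity C c k p V r) :
    RegularField (powAvgSlope k p r) :=
  (D.regularField_powAvg.sub (D.regular.rpow D.p_pos D.mem_Icc)).const_mul k

theorem regularField_normAvgSlope (D : NonlocalDensity C c k p V r) :
    RegularField (normAvgSlope k p r) :=
  ((D.regularField_powAvg.comp (h := fun s => s ^ (1 / p - 1)) (by fun_prop)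
    (continuousOn_id.rpow_const fun _ hs => Or.inl (D.c_pos.trans_le hs.1).ne')
    D.powAvg_mem).const_mul (1 / p)).mul D.regularField_powAvgSlope

theorem regularField_velocity (D : NonlocalDensity C c k p V r) :
    RegularField fun t x => V (normAvg k p r t x) :=
  _root_.regularField_velocity D.k_pos D.p_pos D.C_nonneg D.regular D.mem_Icc
    D.contDiff.continuous

theorem regularField_velocitySlope (D : NonlocalDensity C c k p V r) :
    RegularField (velocitySlope k p V r) :=
  (_root_.regularField_velocity D.k_pos D.p_pos D.C_nonneg D.regular D.mem_Icc
    (D.contDiff.continuous_deriv le_rfl)).mul D.regularField_normAvgSlope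

theorem regularField_powAvgRate (D : NonlocalDensity C c k p V r) :
    RegularField (powAvgRate k p V r) := by
  have h := (((D.regularField_velocity.mul D.regularField_powAvgSlope).const_mul (-1)).sub
    (((D.regularField_velocitySlope.mul D.regularField_powAvg).expTail_field
      D.k_pos).const_mul (p * k))).add
    (((D.regularField_velocitySlope.mul D.regularField_powAvgSlope).expTail_field
      D.k_pos).const_mul (p - 1))
  simpa only [neg_one_mul] using! h

theorem hasDerivAt_powAvg_of_hasDerivAt {t x : ℝ}
    (h : HasDerivAt (expTail k fun y => r t y ^ p)
      (k * expTail k (fun y => r t y ^ p) x - r t x ^ p) x) :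
    HasDerivAt (powAvg k p r t) (powAvgSlope k p r t x) x :=
  h.const_mul k

theorem ae_hasDerivAt_powAvg (D : NonlocalDensity C c k p V r) (t : ℝ) :
    ∀ᵐ x, HasDerivAt (powAvg k p r t) (powAvgSlope k p r t x) x := by
  filter_upwards [ae_hasDerivAt_expTail D.k_pos
    ((D.regular.rpow D.p_pos D.mem_Icc).measurable_section t)
    fun y => abs_rpow_le_of_mem_Icc D.p_pos (D.mem_Icc t y)] with x hx
  exact hasDerivAt_powAvg_of_hasDerivAt hx

theorem hasDerivAt_powAvg_of_continuous (D : NonlocalDensity C c k p V r) {t : ℝ}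
    (hc : Continuous (r t)) (x : ℝ) :
    HasDerivAt (powAvg k p r t) (powAvgSlope k p r t x) x :=
  hasDerivAt_powAvg_of_hasDerivAt (hasDerivAt_expTail_of_continuous D.k_pos
    (hc.rpow_const fun _ => Or.inr D.p_pos.le)
    (fun y => abs_rpow_le_of_mem_Icc D.p_pos (D.mem_Icc t y)) x)

theorem hasDerivAt_normAvg (D : NonlocalDensity C c k p V r) {t x : ℝ}
    (h : HasDerivAt (powAvg k p r t) (powAvgSlope k p r t x) x) :
    HasDerivAt (normAvg k p r t) (normAvgSlope k p r t x) x := by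
  refine (h.rpow_const (p := 1 / p) (Or.inl (D.powAvg_pos t x).ne')).congr_deriv ?_
  rw [normAvgSlope]; ring

theorem lipschitzWith_powAvg (D : NonlocalDensity C c k p V r) (t : ℝ) :
    LipschitzWith (‖k‖₊ * (2 * C ^ p).toNNReal) (powAvg k p r t) := by
  have h := lipschitzWith_expTail D.k_pos
    ((D.regular.rpow D.p_pos D.mem_Icc).measurable_section t)
    fun y => abs_rpow_le_of_mem_Icc D.p_pos (D.mem_Icc t y)
  refine LipschitzWith.of_dist_le_mul fun x y => ?_
  have := h.dist_le_mul x y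
  rw [NNReal.coe_mul, coe_nnnorm, mul_assoc, Real.dist_eq, powAvg, powAvg, ← mul_sub, abs_mul,
    ← Real.norm_eq_abs k]
  exact mul_le_mul_of_nonneg_left this (norm_nonneg _)

theorem contDiffOn_rpow (D : NonlocalDensity C c k p V r) (s : ℝ) :
    ContDiffOn ℝ 1 (fun y : ℝ => y ^ s) (Icc c (C ^ p)) := fun _ hy =>
  (Real.contDiffAt_rpow_const_of_ne (D.c_pos.trans_le hy.1).ne').contDiffWithinAt

theorem exists_lipschitzWith_normAvg (D : NonlocalDensity C c k p V r) :
    ∃ K : NNReal, ∀ t, LipschitzWith K (normAvg k p r t) := by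
  obtain ⟨L, hL⟩ := exists_lipschitzWith_comp (D.contDiffOn_rpow (1 / p))
  exact ⟨_, fun t => hL _ _ (D.lipschitzWith_powAvg t) (D.powAvg_mem t)⟩

theorem exists_lipschitzWith_velocity (D : NonlocalDensity C c k p V r) :
    ∃ K : NNReal, ∀ t, LipschitzWith K fun x => V (normAvg k p r t x) := by
  obtain ⟨K, hK⟩ := D.exists_lipschitzWith_normAvg
  obtain ⟨L, hL⟩ := exists_lipschitzWith_comp (D.contDiff.contDiffOn (s := Icc 0 C))
  exact ⟨_, fun t => hL _ _ (hK t) (normAvg_mem_Icc D.k_pos D.p_pos D.C_nonneg D.mem_Icc t)⟩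

theorem ae_hasDerivAt_velocity (D : NonlocalDensity C c k p V r) (t : ℝ) :
    ∀ᵐ x, HasDerivAt (fun x => V (normAvg k p r t x)) (velocitySlope k p V r t x) x := by
  filter_upwards [D.ae_hasDerivAt_powAvg t] with x hx
  exact ((D.contDiff.differentiable one_ne_zero _).hasDerivAt).comp x (D.hasDerivAt_normAvg hx)

/-- The renormalized flux of `r ^ p` expressed through `powAvg` alone. -/
theorem mul_renormalizedFlux (D : NonlocalDensity C c k p V r) (t x : ℝ) :
    k * renormalizedFlux k (fun t x => V (normAvg k p r t x)) (velocitySlope k p V r)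
      (fun t y => r t y ^ p) (fun t y => p * r t y ^ p * velocitySlope k p V r t y) t x =
      powAvgRate k p V r t x := by
  have hk := D.k_pos
  have hk' := hk.ne'
  have hb := D.regularField_velocity
  have hB := D.regularField_velocitySlope
  have hU := D.regularField_powAvg
  have hu := D.regularField_powAvgSlope
  -- This eliminates the density from the flux.
  have hf : ∀ y, r t y ^ p = powAvg k p r t y - k⁻¹ * powAvgSlope k p r t y := fun y => by
    rw [powAvgSlope]; field_simp; ring
  obtain ⟨K, hK⟩ := D.exists_lipschitzWith_velocity
  obtain ⟨Mb, hMb⟩ := hb.bounded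
  obtain ⟨MU, hMU⟩ := hU.bounded
  obtain ⟨M1, hM1⟩ := (hb.mul hU).bounded
  obtain ⟨M2, hM2⟩ := (hb.mul hu).bounded
  obtain ⟨M3, hM3⟩ := (hB.mul hU).bounded
  obtain ⟨M4, hM4⟩ := (hB.mul hu).bounded
  obtain ⟨M5, hM5⟩ := ((hB.mul hU).add (hb.mul hu)).bounded
  -- Integrating by parts the product V(W) U removes the two tails that contain V(W) itself and
  -- leaves only those with its derivative.
  have hibp := expTail_of_ae_hasDerivAt hk
    ((hK t).mul_of_bounded (D.lipschitzWith_powAvg t) (hMb t) (hMU t)) (hM1 t)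
    (((hB.mul hU).add (hb.mul hu)).measurable_section t) (hM5 t) (by
      filter_upwards [D.ae_hasDerivAt_velocity t, D.ae_hasDerivAt_powAvg t] with y h1 h2
      exact h1.mul h2) x
  rw [expTail_add hk ((hB.mul hU).measurable_section t) ((hb.mul hu).measurable_section t)
    (hM3 t) (hM2 t)] at hibp
  have e1 : expTail k (fun y => V (normAvg k p r t y) * r t y ^ p) x =
      expTail k (fun y => V (normAvg k p r t y) * powAvg k p r t y) x -
        k⁻¹ * expTail k (fun y => V (normAvg k p r t y) * powAvgSlope k p r t y) x := by
    rw [← expTail_const_mul, ← expTail_sub hk ((hb.mul hU).measurable_section t)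
      (((hb.mul hu).const_mul k⁻¹).measurable_section t) (hM1 t) (C₂ := |k⁻¹| * M2)
      (fun y => by rw [abs_mul]; exact mul_le_mul_of_nonneg_left (hM2 t y) (abs_nonneg _))]
    congr 1; ext y; rw [hf]; ring
  have e2 : expTail k (fun y => velocitySlope k p V r t y * r t y ^ p) x =
      expTail k (fun y => velocitySlope k p V r t y * powAvg k p r t y) x -
        k⁻¹ * expTail k (fun y => velocitySlope k p V r t y * powAvgSlope k p r t y) x := by
    rw [← expTail_const_mul, ← expTail_sub hk ((hB.mul hU).measurable_section t)
      (((hB.mul hu).const_mul k⁻¹).measurable_section t) (hM3 t) (C₂ := |k⁻¹| * M4)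
      (fun y => by rw [abs_mul]; exact mul_le_mul_of_nonneg_left (hM4 t y) (abs_nonneg _))]
    congr 1; ext y; rw [hf]; ring
  have e3 : expTail k (fun y => p * r t y ^ p * velocitySlope k p V r t y) x =
      p * expTail k (fun y => velocitySlope k p V r t y * r t y ^ p) x := by
    rw [← expTail_const_mul]
    congr 1; ext y; ring
  rw [renormalizedFlux, powAvgRate, e3, e1, e2, hf x]
  field_simp
  linear_combination k * hibp

/-- The evolution of `powAvg` in integrated form. -/
theorem ae_powAvg_sub (D : NonlocalDensity C c k p V r) {T : ℝ} (hT : 0 ≤ T)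
    (hbal : ∀ h > 0, ∀ t ∈ Icc 0 T, ∀ᵐ x, (∫ y in x..x + h, r t y) - ∫ y in x..x + h, r 0 y =
      -∫ τ in 0..t, (V (normAvg k p r τ (x + h)) * r τ (x + h) - V (normAvg k p r τ x) * r τ x)) :
    ∀ᵐ x, ∀ s ∈ Icc 0 T, ∀ t ∈ Icc 0 T,
      powAvg k p r t x - powAvg k p r s x = ∫ τ in s..t, powAvgRate k p V r τ x := by
  obtain ⟨K, hK⟩ := D.exists_lipschitzWith_velocity
  have H : ContinuityEquation T C K r (fun t x => V (normAvg k p r t x)) (velocitySlope k p V r) :=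
    ⟨D.regular, D.regularField_velocity, D.regularField_velocitySlope, D.mem_Icc, hK,
      D.ae_hasDerivAt_velocity, hbal⟩
  obtain ⟨M, hM⟩ := D.regularField_powAvgRate.bounded
  filter_upwards [H.ae_expTail_rpow_sub hT D.k_pos D.p_pos] with x hx s hs t ht
  have hii : ∀ a b, IntervalIntegrable (fun τ => powAvgRate k p V r τ x) volume a b :=
    intervalIntegrable_of_bound (D.regularField_powAvgRate.measurable_time x) fun τ => hM τ x
  have key : ∀ t ∈ Icc 0 T, powAvg k p r t x - powAvg k p r 0 x =
      ∫ τ in 0..t, powAvgRate k p V r τ x := fun t ht => by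
    rw [powAvg, powAvg, ← mul_sub, hx t ht, ← intervalIntegral.integral_const_mul]
    simp only [D.mul_renormalizedFlux]
  rw [← intervalIntegral.integral_interval_sub_left (hii 0 t) (hii 0 s), ← key t ht, ← key s hs]
  ring

end NonlocalDensity

/-! ### The nonlocal operator -/

theorem expNonlocal_eq_normAvg {C p η : ℝ} {q r : ℝ → ℝ → ℝ} {t : ℝ}
    (hqr : q t =ᵐ[volume] r t) (hrC : ∀ t x, r t x ∈ Icc 0 C) (x : ℝ) :
    expNonlocal p η q t x = normAvg (p / η) p r t x := by
  rw [expNonlocal, normAvg, powAvg, expTail]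
  congr 2
  refine integral_congr_ae ?_
  filter_upwards [ae_restrict_of_ae hqr] with y hy
  rw [hy, Real.mul_rpow (Real.exp_pos _).le (hrC t y).1, ← Real.exp_mul]
  congr 2; ring

/-- The equation at (t,x) sees only the slice at time t and the germ in time at x. This allows the
representative to be replaced by q, which is controlled only for times in [0,T]. -/
theorem NonlocalTransportAt.congr {p η : ℝ} {V : ℝ → ℝ} {W W' : ℝ → ℝ → ℝ} {t x : ℝ}
    (h : NonlocalTransportAt p η V W t x) (h1 : W' t = W t)
    (h2 : (fun s => W' s x) =ᶠ[𝓝 t] fun s => W s x) : NonlocalTransportAt p η V W' t x := by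
  unfold NonlocalTransportAt at h ⊢
  rw [h1, h2.deriv_eq]
  exact ⟨h2.differentiableAt_iff.2 h.1, h.2⟩

/-- Needed to apply Fubini to the set of points where a partial derivative exists with the
prescribed value. -/
theorem measurableSet_hasDerivAt_with_param {F f : ℝ → ℝ → ℝ}
    (hF : Continuous (Function.uncurry F)) (hf : Measurable (Function.uncurry f)) :
    MeasurableSet {z : ℝ × ℝ | HasDerivAt (F z.1) (f z.1 z.2) z.2} := by
  have h : {z : ℝ × ℝ | HasDerivAt (F z.1) (f z.1 z.2) z.2} =
      {z : ℝ × ℝ | DifferentiableAt ℝ (F z.1) z.2} ∩ {z | deriv (F z.1) z.2 = f z.1 z.2} := by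
    ext z
    exact ⟨fun h => ⟨h.differentiableAt, h.deriv⟩, fun h => by
      have := h.1.hasDerivAt
      rwa [h.2] at this⟩
  rw [h]
  exact (measurableSet_of_differentiableAt_with_param ℝ hF).inter
    (measurableSet_eq_fun (measurable_deriv_with_param hF) hf)

theorem measurableSet_hasDerivAt_fst {F f : ℝ → ℝ → ℝ}
    (hF : Continuous (Function.uncurry F)) (hf : Measurable (Function.uncurry f)) :
    MeasurableSet {z : ℝ × ℝ | HasDerivAt (fun s => F s z.2) (f z.1 z.2) z.1} :=
  measurable_swap (measurableSet_hasDerivAt_with_param (F := fun x s => F s x)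
    (f := fun x s => f s x) (hF.comp continuous_swap) (hf.comp measurable_swap))

/-! ### Pointwise identity and transport equation for W -/

namespace NonlocalDensity

variable {C c p η : ℝ} {V : ℝ → ℝ} {r : ℝ → ℝ → ℝ}

theorem nonlocalIdentityAt (D : NonlocalDensity C c (p / η) p V r) (hη : 0 < η) {t x : ℝ}
    (h : HasDerivAt (powAvg (p / η) p r t) (powAvgSlope (p / η) p r t x) x) :
    NonlocalIdentityAt p η r (normAvg (p / η) p r) t x := by
  have h' := D.hasDerivAt_normAvg h
  refine ⟨h'.differentiableAt, ?_⟩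
  rw [h'.deriv, normAvgSlope, D.powAvg_rpow, D.normAvg_rpow_self, powAvgSlope]
  have hp := D.p_pos.ne'
  have := hη.ne'
  have e := D.normAvg_rpow_mul t x
  field_simp
  linear_combination (powAvg (p / η) p r t x - r t x ^ p) * e

theorem nonlocalTransportAt (D : NonlocalDensity C c (p / η) p V r) {t x : ℝ}
    (ht : HasDerivAt (fun s => powAvg (p / η) p r s x) (powAvgRate (p / η) p V r t x) t)
    (hx : HasDerivAt (powAvg (p / η) p r t) (powAvgSlope (p / η) p r t x) x) :
    NonlocalTransportAt p η V (normAvg (p / η) p r) t x := by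
  have hp := D.p_pos.ne'
  have hx' := D.hasDerivAt_normAvg hx
  have ht' : HasDerivAt (fun s => normAvg (p / η) p r s x)
      (1 / p * normAvg (p / η) p r t x ^ (1 - p) * powAvgRate (p / η) p V r t x) t := by
    refine (ht.rpow_const (p := 1 / p) (Or.inl (D.powAvg_pos t x).ne')).congr_deriv ?_
    rw [D.powAvg_rpow]; ring
  have hae : ∀ᵐ y, deriv (normAvg (p / η) p r t) y = normAvgSlope (p / η) p r t y := by
    filter_upwards [D.ae_hasDerivAt_powAvg t] with y hy using (D.hasDerivAt_normAvg hy).deriv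
  have he : ∀ y, Real.exp ((p * x - p * y) / η) = Real.exp (p / η * (x - y)) := fun y => by
    congr 1; ring
  have hf1 : (fun y => Real.exp (p / η * (x - y)) *
        (velocitySlope (p / η) p V r t y * powAvg (p / η) p r t y)) =ᵐ[volume.restrict (Ioi x)]
      fun y => Real.exp ((p * x - p * y) / η) * deriv V (normAvg (p / η) p r t y) *
        deriv (normAvg (p / η) p r t) y * normAvg (p / η) p r t y ^ p := by
    filter_upwards [ae_restrict_of_ae hae] with y hy
    rw [hy, he, D.normAvg_rpow_self, velocitySlope]; ring
  -- Since u = p W^{p-1} ∂W, the square (∂W)² W^{p-1} equals ∂W · u / p, whence the factor 1/p.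
  have hf2 : (fun y => p⁻¹ * (Real.exp (p / η * (x - y)) *
        (velocitySlope (p / η) p V r t y * powAvgSlope (p / η) p r t y)))
      =ᵐ[volume.restrict (Ioi x)]
      fun y => Real.exp ((p * x - p * y) / η) * deriv V (normAvg (p / η) p r t y) *
        normAvg (p / η) p r t y ^ (p - 1) * deriv (normAvg (p / η) p r t) y ^ 2 := by
    filter_upwards [ae_restrict_of_ae hae] with y hy
    have e := D.normAvg_rpow_mul t y
    rw [hy, he, velocitySlope, normAvgSlope, D.powAvg_rpow]
    field_simp
    linear_combination (-(deriv V (normAvg (p / η) p r t y) *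
      normAvg (p / η) p r t y ^ (1 - p) * powAvgSlope (p / η) p r t y ^ 2)) * e
  have hB := D.regularField_velocitySlope
  obtain ⟨M1, hM1⟩ := (hB.mul D.regularField_powAvg).bounded
  obtain ⟨M2, hM2⟩ := (hB.mul D.regularField_powAvgSlope).bounded
  have hi1 := integrableOn_exp_mul D.k_pos
    ((hB.mul D.regularField_powAvg).measurable_section t) (hM1 t) x x
  have hi2 := (integrableOn_exp_mul D.k_pos
    ((hB.mul D.regularField_powAvgSlope).measurable_section t) (hM2 t) x x).const_mul p⁻¹
  refine ⟨ht'.differentiableAt, hx'.differentiableAt, hi1.congr hf1, hi2.congr hf2, ?_⟩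
  rw [ht'.deriv, hx'.deriv, ← integral_congr_ae hf1, ← integral_congr_ae hf2, integral_const_mul,
    normAvgSlope, D.powAvg_rpow, powAvgRate, expTail, expTail]
  field_simp

theorem continuous_powAvg (D : NonlocalDensity C c (p / η) p V r) :
    Continuous (Function.uncurry (powAvg (p / η) p r)) :=
  _root_.continuous_powAvg D.k_pos D.p_pos D.regular D.mem_Icc

theorem ae_nonlocalTransportAt (D : NonlocalDensity C c (p / η) p V r) {T : ℝ}
    (hev : ∀ᵐ x, ∀ s ∈ Icc 0 T, ∀ t ∈ Icc 0 T, powAvg (p / η) p r t x - powAvg (p / η) p r s x =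
      ∫ τ in s..t, powAvgRate (p / η) p V r τ x) :
    ∀ᵐ z ∂(volume.restrict (spaceTime T)),
      NonlocalTransportAt p η V (normAvg (p / η) p r) z.1 z.2 := by
  rw [volume_restrict_spaceTime]
  have hspace : ∀ᵐ z ∂((volume.restrict (Ioo 0 T)).prod (volume : Measure ℝ)),
      HasDerivAt (powAvg (p / η) p r z.1) (powAvgSlope (p / η) p r z.1 z.2) z.2 :=
    (Measure.ae_prod_iff_ae_ae (p := fun z =>
      HasDerivAt (powAvg (p / η) p r z.1) (powAvgSlope (p / η) p r z.1 z.2) z.2)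
      (measurableSet_hasDerivAt_with_param D.continuous_powAvg
        D.regularField_powAvgSlope.measurable)).2
      (Eventually.of_forall fun t => D.ae_hasDerivAt_powAvg t)
  have hmeas := measurableSet_hasDerivAt_fst D.continuous_powAvg
    D.regularField_powAvgRate.measurable
  have htime : ∀ᵐ z ∂((volume.restrict (Ioo 0 T)).prod (volume : Measure ℝ)),
      HasDerivAt (fun s => powAvg (p / η) p r s z.2) (powAvgRate (p / η) p V r z.1 z.2) z.1 := by
    refine (Measure.ae_prod_iff_ae_ae (p := fun z : ℝ × ℝ => HasDerivAt (fun s =>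
      powAvg (p / η) p r s z.2) (powAvgRate (p / η) p V r z.1 z.2) z.1) hmeas).2 ?_
    -- The evolution identity is available for almost every x, and Lebesgue differentiation in time
    -- then gives almost every t, so the order of the variables has to be exchanged.
    refine (Measure.ae_ae_comm (p := fun t x => HasDerivAt (fun s =>
      powAvg (p / η) p r s x) (powAvgRate (p / η) p V r t x) t) hmeas).2 ?_
    obtain ⟨M, hM⟩ := D.regularField_powAvgRate.bounded
    filter_upwards [hev] with x hx
    filter_upwards [ae_restrict_of_ae (LocallyIntegrable.ae_hasDerivAt_integral
      (locallyIntegrable_of_bound (D.regularField_powAvgRate.measurable_time x)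
        fun τ => hM τ x)), ae_restrict_mem measurableSet_Ioo] with t h1 h2
    refine ((h1 0).const_add (powAvg (p / η) p r 0 x)).congr_of_eventuallyEq ?_
    filter_upwards [isOpen_Ioo.mem_nhds h2] with s hs
    rw [← hx 0 ⟨le_rfl, (h2.1.trans h2.2).le⟩ s (Ioo_subset_Icc_self hs)]
    ring
  filter_upwards [hspace, htime] with z h1 h2
  exact D.nonlocalTransportAt h2 h1

theorem continuous_powAvgRate_of_continuous (D : NonlocalDensity C c (p / η) p V r) {t : ℝ}
    (hc : Continuous (r t)) : Continuous (powAvgRate (p / η) p V r t) := by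
  have hU : Continuous (powAvg (p / η) p r t) := (D.lipschitzWith_powAvg t).continuous
  obtain ⟨K, hK⟩ := D.exists_lipschitzWith_velocity
  have hu : Continuous (powAvgSlope (p / η) p r t) :=
    (hU.sub (hc.rpow_const fun _ => Or.inr D.p_pos.le)).const_mul _
  have h1 := ((D.regularField_velocitySlope.mul D.regularField_powAvg).continuous_expTail
    D.k_pos).comp (Continuous.prodMk_right t)
  have h2 := ((D.regularField_velocitySlope.mul D.regularField_powAvgSlope).continuous_expTail
    D.k_pos).comp (Continuous.prodMk_right t)
  exact (((hK t).continuous.mul hu).neg.sub (h1.const_mul _)).add (h2.const_mul _)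

theorem continuousOn_powAvgRate_time (D : NonlocalDensity C c (p / η) p V r) {S : Set ℝ} {x : ℝ}
    (hc : ContinuousOn (fun t => r t x) S) :
    ContinuousOn (fun t => powAvgRate (p / η) p V r t x) S := by
  have hU : Continuous fun t => powAvg (p / η) p r t x :=
    D.continuous_powAvg.comp (Continuous.prodMk_left x)
  have hb : Continuous fun t => V (normAvg (p / η) p r t x) :=
    D.contDiff.continuous.comp (hU.rpow_const fun t => Or.inl (D.powAvg_pos t x).ne')
  have hu : ContinuousOn (fun t => powAvgSlope (p / η) p r t x) S :=
    (hU.continuousOn.sub (hc.rpow_const fun _ _ => Or.inr D.p_pos.le)).const_mul _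
  have h1 := ((D.regularField_velocitySlope.mul D.regularField_powAvg).continuous_expTail
    D.k_pos).comp (Continuous.prodMk_left x)
  have h2 := ((D.regularField_velocitySlope.mul D.regularField_powAvgSlope).continuous_expTail
    D.k_pos).comp (Continuous.prodMk_left x)
  exact ((hb.continuousOn.mul hu).neg.sub (h1.const_mul _).continuousOn).add
    (h2.const_mul _).continuousOn

/-- The rate contains r only as a local value outside the tails. It is thus continuous in x, which
extends the integrated identity to every x, and continuous in t, which allows it to be
differentiated at every t. The integrals start at the interior time t because continuity of r is
assumed only on (0,T). -/
theorem hasDerivAt_powAvg_time_of_continuousOn (D : NonlocalDensity C c (p / η) p V r) {T : ℝ}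
    (hev : ∀ᵐ x, ∀ s ∈ Icc 0 T, ∀ t ∈ Icc 0 T, powAvg (p / η) p r t x - powAvg (p / η) p r s x =
      ∫ τ in s..t, powAvgRate (p / η) p V r τ x)
    (hx : ∀ t ∈ Ioo 0 T, Continuous (r t)) (ht : ∀ x, ContinuousOn (fun t => r t x) (Ioo 0 T))
    {t : ℝ} (htT : t ∈ Ioo 0 T) (x : ℝ) :
    HasDerivAt (fun s => powAvg (p / η) p r s x) (powAvgRate (p / η) p V r t x) t := by
  obtain ⟨M, hM⟩ := D.regularField_powAvgRate.bounded
  have hsub : ∀ s ∈ Ioo 0 T, uIcc t s ⊆ Ioo 0 T := fun s hs => ordConnected_Ioo.uIcc_subset htT hs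
  have key : ∀ s ∈ Ioo 0 T, powAvg (p / η) p r s x - powAvg (p / η) p r t x =
      ∫ τ in t..s, powAvgRate (p / η) p V r τ x := by
    intro s hs
    have hc1 : Continuous fun x => powAvg (p / η) p r s x - powAvg (p / η) p r t x :=
      (D.lipschitzWith_powAvg s).continuous.sub (D.lipschitzWith_powAvg t).continuous
    have hc2 : Continuous fun x => ∫ τ in t..s, powAvgRate (p / η) p V r τ x := by
      rw [continuous_iff_continuousAt]
      intro y
      refine intervalIntegral.tendsto_integral_filter_of_dominated_convergence (fun _ => M)
        (Eventually.of_forall fun y =>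
          (D.regularField_powAvgRate.measurable_time y).aestronglyMeasurable)
        (Eventually.of_forall fun y => Eventually.of_forall fun τ _ => hM τ y)
        intervalIntegrable_const (Eventually.of_forall fun τ hτ => ?_)
      exact (D.continuous_powAvgRate_of_continuous
        (hx τ (hsub s hs (uIoc_subset_uIcc hτ)))).tendsto y
    have := (hc1.ae_eq_iff_eq volume hc2).1 (hev.mono fun x hx =>
      hx t (Ioo_subset_Icc_self htT) s (Ioo_subset_Icc_self hs))
    exact congrFun this x
  have hcont := (D.continuousOn_powAvgRate_time (ht x)).continuousAt (isOpen_Ioo.mem_nhds htT)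
  have hd := intervalIntegral.integral_hasDerivAt_right (a := t)
    (f := fun τ => powAvgRate (p / η) p V r τ x) (by simp)
    ((D.regularField_powAvgRate.measurable_time x).stronglyMeasurable.stronglyMeasurableAtFilter)
    hcont
  refine (hd.const_add (powAvg (p / η) p r t x)).congr_of_eventuallyEq ?_
  filter_upwards [isOpen_Ioo.mem_nhds htT] with s hs
  rw [← key s hs]; ring

/-- A bounded rate gives a time-Lipschitz bound on U for almost every x, hence for every x because
it is a closed condition. The power s^{1/p} preserves it since U lies in a compact interval away
from 0. -/
theorem exists_lipschitzOnWith_normAvg (D : NonlocalDensity C c (p / η) p V r) {T : ℝ}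
    (hev : ∀ᵐ x, ∀ s ∈ Icc 0 T, ∀ t ∈ Icc 0 T, powAvg (p / η) p r t x - powAvg (p / η) p r s x =
      ∫ τ in s..t, powAvgRate (p / η) p V r τ x) :
    ∃ K : NNReal, LipschitzOnWith K (fun z : ℝ × ℝ => normAvg (p / η) p r z.1 z.2)
      (Icc 0 T ×ˢ (univ : Set ℝ)) := by
  obtain ⟨M, hM⟩ := D.regularField_powAvgRate.bounded
  have hM0 : 0 ≤ M := (abs_nonneg _).trans (hM 0 0)
  obtain ⟨K, hK⟩ := D.exists_lipschitzWith_normAvg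
  obtain ⟨L, hL⟩ := (D.contDiffOn_rpow (1 / p)).exists_lipschitzOnWith (by decide)
    (convex_Icc _ _) isCompact_Icc
  have htime : ∀ s ∈ Icc 0 T, ∀ t ∈ Icc 0 T, ∀ x,
      |powAvg (p / η) p r t x - powAvg (p / η) p r s x| ≤ M * |t - s| := by
    intro s hs t ht x
    have hae : ∀ᵐ x, |powAvg (p / η) p r t x - powAvg (p / η) p r s x| ≤ M * |t - s| := by
      filter_upwards [hev] with x hx
      rw [hx s hs t ht]
      exact abs_intervalIntegral_le_of_bound (fun τ => hM τ x) s t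
    have hcl : IsClosed {x | |powAvg (p / η) p r t x - powAvg (p / η) p r s x| ≤ M * |t - s|} :=
      isClosed_le (((D.lipschitzWith_powAvg t).continuous.sub
        (D.lipschitzWith_powAvg s).continuous).abs) continuous_const
    have := (Measure.dense_of_ae hae).closure_eq
    rw [hcl.closure_eq] at this
    exact this.symm.subset (mem_univ x)
  refine ⟨L * M.toNNReal + K, LipschitzOnWith.of_dist_le_mul fun z hz w hw => ?_⟩
  have h1 : dist (normAvg (p / η) p r z.1 z.2) (normAvg (p / η) p r w.1 z.2) ≤
      L * (M * dist z.1 w.1) := by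
    refine (hL.dist_le_mul _ (D.powAvg_mem _ _) _ (D.powAvg_mem _ _)).trans ?_
    exact mul_le_mul_of_nonneg_left (htime _ hw.1 _ hz.1 _) L.2
  have h2 := (hK w.1).dist_le_mul z.2 w.2
  have h3 : dist z.1 w.1 ≤ dist z w := le_max_left _ _
  have h4 : dist z.2 w.2 ≤ dist z w := le_max_right _ _
  rw [NNReal.coe_add, NNReal.coe_mul, Real.coe_toNNReal M hM0]
  calc _ ≤ _ := dist_triangle _ (normAvg (p / η) p r w.1 z.2) _
    _ ≤ L * (M * dist z w) + K * dist z w := by 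
        exact add_le_add (h1.trans (by gcongr)) (h2.trans (by gcongr))
    _ = _ := by ring

end NonlocalDensity

/-! ### Assembly of the theorem -/

/-- A weak solution has a Borel representative that is a nonlocal density obeying the integrated
balance law. -/
theorem IsNonlocalWeakSolution.exists_nonlocalDensity {T p η qmin : ℝ} {V q₀ : ℝ → ℝ}
    {q : ℝ → ℝ → ℝ} (hT : 0 < T) (hp : 0 < p) (hη : 0 < η) (hV : VelocityAssumption V)
    (hq₀ : InitialDatumAssumption q₀ qmin) (hq : IsNonlocalWeakSolution T p η V q₀ q) :
    ∃ (C c : ℝ) (r : ℝ → ℝ → ℝ), NonlocalDensity C c (p / η) p V r ∧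
      (∀ t ∈ Icc 0 T, q t =ᵐ[volume] r t) ∧ (∀ t ∈ Icc 0 T, Continuous (q t) → r t = q t) ∧
      r 0 =ᵐ[volume] q₀ ∧
      ∀ᵐ x, ∀ s ∈ Icc 0 T, ∀ t ∈ Icc 0 T, powAvg (p / η) p r t x - powAvg (p / η) p r s x =
        ∫ τ in s..t, powAvgRate (p / η) p V r τ x := by
  obtain ⟨C, hC⟩ := hq.bounded
  obtain ⟨r, hr, hrC, hrπ, hqr, hrc⟩ := hq.continuous_locL1.exists_regularField hT hq.nonneg hC
  have hk : 0 < p / η := by positivity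
  have hC0 : 0 ≤ C := (hrC 0 0).1.trans (hrC 0 0).2
  have hVd := hV.contDiff
  have hb := regularField_velocity hk hp hC0 hr hrC hV.continuous
  have hq₀l : LocallyIntegrable q₀ volume := hq₀.memLp.locallyIntegrable le_top
  have hweak : ∀ ψ : ℝ → ℝ, ContDiff ℝ 1 ψ → HasCompactSupport ψ → ∀ t ∈ Icc 0 T,
      ∫ x, ψ x * r t x = (∫ x, ψ x * q₀ x) +
        ∫ τ in 0..t, ∫ x, deriv ψ x * (V (normAvg (p / η) p r τ x) * r τ x) :=
    fun ψ hψ hψc t ht => integral_mul_eq_of_weak_form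
      (v := fun t x => V (expNonlocal p η q t x)) hT hr hb hq.aestronglyMeasurable hqr
      (fun t ht x => by rw [expNonlocal_eq_normAvg (hqr t ht) hrC]) hq.weak_form hψ hψc ht
  have hr0 : r 0 =ᵐ[volume] q₀ := ae_eq_initial_of_weak_form hT hr hq₀l hweak
  have hbal : ∀ h > 0, ∀ t ∈ Icc 0 T, ∀ᵐ x,
      (∫ y in x..x + h, r t y) - ∫ y in x..x + h, r 0 y =
      -∫ τ in 0..t, (V (normAvg (p / η) p r τ (x + h)) * r τ (x + h) -
        V (normAvg (p / η) p r τ x) * r τ x) :=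
    fun h _ t ht => ae_balance_of_weak_form hr hb hr0 hweak h ht
  obtain ⟨M, hM⟩ := (hb.mul hr).bounded
  -- Only the bounded flux and the balance law enter here; the Lipschitz regularity of the velocity
  -- is derived from this bound.
  obtain ⟨c, hc, hlow⟩ := exists_lower_bound_expTail_rpow hk hp hT.le hr hrC hM hq₀.qmin_pos
    (by filter_upwards [hr0, hq₀.gt_qmin] with x h1 h2; rw [h1]; exact h2.le) hbal
  have D : NonlocalDensity C (p / η * c) (p / η) p V r :=
    ⟨hk, hp, by positivity, hVd, hr, hrC, fun t x => by
      -- Clamping carries the bound from [0,T] to all times.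
      rw [powAvg, hrπ t]
      exact mul_le_mul_of_nonneg_left
        (hlow _ ⟨le_max_left _ _, max_le hT.le (min_le_left _ _)⟩ x) hk.le⟩
  exact ⟨C, _, r, D, hqr, hrc, hr0, D.ae_powAvg_sub hT.le hbal⟩

theorem mainTheorem12 (T p η qmin : ℝ) (hT : 0 < T) (hp : 0 < p) (hη : 0 < η)
    (V q₀ : ℝ → ℝ) (hV : VelocityAssumption V) (hq₀ : InitialDatumAssumption q₀ qmin)
    (q : ℝ → ℝ → ℝ) (hq : IsNonlocalWeakSolution T p η V q₀ q)
    (W : ℝ → ℝ → ℝ) (hW : W = expNonlocal p η q) :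
    -- `W` is positive and Lipschitz continuous on `[0,T] × ℝ`
    (∀ t ∈ Icc 0 T, ∀ x : ℝ, 0 < W t x) ∧
    (∃ K : NNReal, LipschitzOnWith K (fun z : ℝ × ℝ => W z.1 z.2)
      (Icc 0 T ×ˢ (univ : Set ℝ))) ∧
    -- the identity recovering `q` from `W`
    (∀ t ∈ Icc 0 T, ∀ᵐ x : ℝ, NonlocalIdentityAt p η q W t x) ∧
    -- the Cauchy problem for `W`
    (∀ᵐ z ∂(volume.restrict (spaceTime T)), NonlocalTransportAt p η V W z.1 z.2) ∧
    (∀ x : ℝ, W 0 x =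
      ((p / η) * ∫ y in Ioi x, (Real.exp ((x - y) / η) * q₀ y) ^ p) ^ (1 / p)) ∧
    -- for continuous solutions the identity and the equation hold at every point
    (ContinuousOn (fun z : ℝ × ℝ => q z.1 z.2) (spaceTime T) →
      ∀ t ∈ Ioo 0 T, ∀ x : ℝ,
        NonlocalIdentityAt p η q W t x ∧ NonlocalTransportAt p η V W t x) := by
  obtain ⟨C, c, r, D, hqr, hrc, hr0, hev⟩ := hq.exists_nonlocalDensity hT hp hη hV hq₀
  have hWr : ∀ t ∈ Icc 0 T, W t = normAvg (p / η) p r t := fun t ht => by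
    ext x; rw [hW, expNonlocal_eq_normAvg (hqr t ht) D.mem_Icc]
  have hWt : ∀ t ∈ Ioo 0 T, ∀ x, (fun s => W s x) =ᶠ[𝓝 t] fun s => normAvg (p / η) p r s x :=
    fun t ht x => by
      filter_upwards [isOpen_Ioo.mem_nhds ht] with s hs
      rw [hWr s (Ioo_subset_Icc_self hs)]
  have hid : ∀ t ∈ Icc 0 T, ∀ x, q t x = r t x →
      HasDerivAt (powAvg (p / η) p r t) (powAvgSlope (p / η) p r t x) x →
      NonlocalIdentityAt p η q W t x := fun t ht x hqx hx => by
    have := D.nonlocalIdentityAt hη hx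
    unfold NonlocalIdentityAt at this ⊢
    rwa [hqx, hWr t ht]
  refine ⟨fun t ht x => ?_, ?_, fun t ht => ?_, ?_, fun x => ?_, fun hcont t ht x => ?_⟩
  · rw [hWr t ht]; exact D.normAvg_pos t x
  · obtain ⟨K, hK⟩ := D.exists_lipschitzOnWith_normAvg hev
    refine ⟨K, fun z hz w hw => ?_⟩
    simpa only [hWr z.1 hz.1, hWr w.1 hw.1] using hK hz hw
  · filter_upwards [hqr t ht, D.ae_hasDerivAt_powAvg t] with x h1 h2 using hid t ht x h1 h2
  · filter_upwards [D.ae_nonlocalTransportAt hev,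
      ae_restrict_mem (measurableSet_Ioo.prod MeasurableSet.univ)] with z h1 h2
    exact h1.congr (hWr _ (Ioo_subset_Icc_self h2.1)) (hWt _ h2.1 _)
  -- The initial datum is treated as a density constant in time, so that the same comparison with
  -- the representative applies.
  · have h1 : expNonlocal p η (fun _ => q₀) 0 x = normAvg (p / η) p r 0 x :=
      expNonlocal_eq_normAvg (q := fun _ => q₀) hr0.symm D.mem_Icc x
    rw [hWr 0 ⟨le_rfl, hT.le⟩, ← h1, expNonlocal]
  · have hqx : ∀ s ∈ Ioo 0 T, Continuous (q s) := fun s hs =>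
      hcont.comp_continuous (Continuous.prodMk_right s) fun y => ⟨hs, mem_univ y⟩
    have hreq : ∀ s ∈ Ioo 0 T, r s = q s := fun s hs =>
      hrc s (Ioo_subset_Icc_self hs) (hqx s hs)
    have hrx : ∀ s ∈ Ioo 0 T, Continuous (r s) := fun s hs => by
      rw [hreq s hs]; exact hqx s hs
    have hrt : ∀ y, ContinuousOn (fun s => r s y) (Ioo 0 T) := fun y => by
      refine (hcont.comp (Continuous.prodMk_left y).continuousOn
        fun s hs => ⟨hs, mem_univ y⟩).congr fun s hs => ?_
      simp only [hreq s hs, Function.comp]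
    have hx := D.hasDerivAt_powAvg_of_continuous (hrx t ht) x
    have ht' := Ioo_subset_Icc_self ht
    exact ⟨hid t ht' x (by rw [hreq t ht]) hx, (D.nonlocalTransportAt
      (D.hasDerivAt_powAvg_time_of_continuousOn hev hrx hrt ht x) hx).congr (hWr t ht')
      (hWt t ht x)⟩
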